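/- **Setting.** For a set $X$, $l(X)$ denotes the real functions on $X$. A resistance form on a finite set $V$ is a form $\mathcal E_V(f)=\frac12\sum_{x\ne y}c_{x,y}(f(x)-f(y))^2$ on $l(V)$ with $c_{x,y}=c_{y,x}\ge 0$ such that $\mathcal E_V(f)=0$ if and only if $f$ is constant. A function $R\in l(X\times X)$ is a *resistance metric* on $X$, written $R\in\mathcal{RM}(X)$, if for every finite $V\subset X$ there is a resistance form $\mathcal E_V$ on $V$ with $$R(x,y)=\sup\Big\{\tfrac{|f(x)-f(y)|^2}{\mathcal E_V(f)}: f\in l(V)\text{ non-constant}\Big\}\qquad (x,y\in V),\qquad \sup\emptyset:=0.$$ A *resistance form* on a set $X$ is a pair $(\mathcal E,\mathcal F)$ such that: (RF1) $\mathcal F$ is a linear subspace of $l(X)$ containing the constants, $\mathcal E$ is a nonnegative symmetric bilinear form on $\mathcal F$, and $\mathcal E(f):=\mathcal E(f,f)=0$ if and only if $f$ is constant; (RF2) $\mathcal F$ modulo constants, with inner product $\mathcal E$, is a Hilbert space; (RF3) every real function on a finite subset of $X$ extends to an element of $\mathcal F$; (RF4) for all distinct $p,q\in X$, $\sup\{|f(p)-f(q)|^2/\mathcal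 E(f): f\in\mathcal F\text{ non-constant}\}<\infty$; (RF5) if $f\in\mathcal F$, then $\bar f=(f\vee 0)\wedge 1\in\mathcal F$ and $\mathcal E(\bar f)\le\mathcal E(f)$. The supremum in (RF4) (and $0$ for $p=q$) is the resistance metric associated with $(\mathcal E,\mathcal F)$. For $\alpha>0$, a resistance metric $R$ on $X$ and a probability measure $\nu$ on $X$, the *resolvent kernel* associated with $R$ and $\nu$ is the function $u^{(\alpha)}$ on $X\times X$ such that, for every $x\in X$, $u^{(\alpha)}(x,\cdot)\in\mathcal F$ and $$\mathcal E\big(u^{(\alpha)}(x,\cdot),f\big)+\alpha\int_X u^{(\alpha)}(x,y)f(y)\,d\nu(y)=f(x)\qquad\text{for all } f\in\mathcal F,$$ where $(\mathcal E,\mathcal F)$ is a resistance form on $X$ whose associated resistance metric is $R$. **Theorem.** Let $(B,d)$ be a compact metric space and let $A_n$ $(n\ge1)$ and $A$ be compact subsets of $B$ with $A_n\to A$ in the Hausdorff metric. Let $\mu_n$ $(n\ge 1)$ and $\mu$ be Borel probability measures on $B$ with supports $A_n$ and $A$ respectively, such that $\mu_n\to\mu$ weakly. For functions $f_n$ on $A_n\times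 A_n$ and $f$ on $A\times A$ write $f_n\rightarrowtail f$ if $f_n(x_n,y_n)\to f(x,y)$ whenever $x_n,y_n\in A_n$, $x,y\in A$, $x_n\to x$ and $y_n\to y$. For each $n$ let $R_n$ be a resistance metric on $A_n$ that is continuous on $A_n\times A_n$ with respect to $d$, and assume that $R_n\rightarrowtail R$ for some metric $R$ on $A$. Then $R$ is a resistance metric on $A$ and is continuous on $A\times A$ with respect to $d$. Moreover, for every $\alpha>0$ the resolvent kernels $u_n^{(\alpha)}$ associated with $R_n,\mu_n$ and $u^{(\alpha)}$ associated with $R,\mu$ exist and are unique, each $u_n^{(\alpha)}$ is continuous on $A_n\times A_n$, and $$u_n^{(\alpha)}\rightarrowtail u^{(\alpha)}.$$ -/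

import Mathlib

open Filter Topology MeasureTheory

/-- `f` is a constant function. -/
def IsConstFun {X : Type*} (f : X → ℝ) : Prop := ∃ c : ℝ, ∀ x, f x = c

/-- `R` is a metric on the set `X` (as a bare real-valued function of two variables). -/
structure IsMetricOn {X : Type*} (R : X → X → ℝ) : Prop where
  nonneg : ∀ x y, 0 ≤ R x y
  eq_zero_iff : ∀ x y, R x y = 0 ↔ x = y
  symm : ∀ x y, R x y = R y x
  triangle : ∀ x y z, R x z ≤ R x y + R y z

/-- The quadratic form `½ ∑_{x ≠ y} c(x,y) (f(x) - f(y))²` of a conductance function `c` on a finite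
set (the diagonal terms of the double sum vanish). -/
noncomputable def conductanceEnergy {V : Type*} [Fintype V] (c : V → V → ℝ) (f : V → ℝ) : ℝ :=
  (1 / 2) * ∑ x, ∑ y, c x y * (f x - f y) ^ 2

/-- `c` is a system of conductances on the finite set `V` whose quadratic form is a resistance form
on `V`: it is symmetric and nonnegative, and only constant functions have zero energy. -/
structure IsConductance {V : Type*} [Fintype V] (c : V → V → ℝ) : Prop where
  symm : ∀ x y, c x y = c y x
  nonneg : ∀ x y, 0 ≤ c x y
  energy_eq_zero_iff : ∀ f : V → ℝ, conductanceEnergy c f = 0 ↔ IsConstFun f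

/-- The effective resistance on a finite set. The supremum is that of a bounded set of nonnegative
numbers; it is `0` when `V` has only one point, where every function is constant. -/
noncomputable def conductanceResistance {V : Type*} [Fintype V] (c : V → V → ℝ) (x y : V) : ℝ :=
  sSup {r : ℝ | ∃ f : V → ℝ, ¬ IsConstFun f ∧ r = |f x - f y| ^ 2 / conductanceEnergy c f}

/-- `R` is a resistance metric on `X`: on each finite subset it is the effective resistance of a
resistance form on that subset. -/
def IsResistanceMetric {X : Type*} (R : X → X → ℝ) : Prop :=
  ∀ V : Finset X, ∃ c : V → V → ℝ, IsConductance c ∧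
    ∀ x y : V, R x y = conductanceResistance c x y

/-- Resistance forms `(E, F)` on a set `X`. -/
structure ResistanceForm (X : Type*) where
  /-- the domain `F`, a linear space of functions on `X` -/
  domain : Submodule ℝ (X → ℝ)
  /-- the bilinear form `E` on `F` -/
  form : domain →ₗ[ℝ] domain →ₗ[ℝ] ℝ
  /-- (RF1) -/
  const_mem : ∀ c : ℝ, (fun _ => c) ∈ domain
  symm : ∀ f g, form f g = form g f
  nonneg : ∀ f, 0 ≤ form f f
  form_self_eq_zero_iff : ∀ f : domain, form f f = 0 ↔ IsConstFun (f : X → ℝ)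
  /-- (RF2): `F` modulo constants, with the inner product `E`, is complete -/
  complete : ∀ f : ℕ → domain,
    (∀ ε > 0, ∃ N, ∀ m ≥ N, ∀ n ≥ N, form (f m - f n) (f m - f n) < ε) →
    ∃ g : domain, Tendsto (fun n => form (f n - g) (f n - g)) atTop (𝓝 0)
  /-- (RF3) -/
  exists_extension : ∀ (V : Finset X) (u : V → ℝ), ∃ f : domain, ∀ p : V, (f : X → ℝ) p = u p
  /-- (RF4) -/
  resistance_finite : ∀ p q : X, p ≠ q →
    BddAbove {r : ℝ | ∃ f : domain, ¬ IsConstFun (f : X → ℝ) ∧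
      r = |(f : X → ℝ) p - (f : X → ℝ) q| ^ 2 / form f f}
  /-- (RF5), the Markov property -/
  markov : ∀ f : domain, ∃ h : (fun x => min (max ((f : X → ℝ) x) 0) 1) ∈ domain,
    form ⟨_, h⟩ ⟨_, h⟩ ≤ form f f

/-- The resistance metric of a resistance form. -/
noncomputable def ResistanceForm.resistance {X : Type*} (𝓔 : ResistanceForm X) (p q : X) : ℝ :=
  sSup {r : ℝ | ∃ f : 𝓔.domain, ¬ IsConstFun (f : X → ℝ) ∧
    r = |(f : X → ℝ) p - (f : X → ℝ) q| ^ 2 / 𝓔.form f f}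

/-- `u` is a resolvent kernel of order `α` of `R` and `ν`: for the resistance form `(E, F)` with
resistance metric `R`, each `u(x, ·)` lies in `F` and satisfies
`E(u(x, ·), f) + α ∫ u(x, ·) f dν = f(x)` for all `f` in `F`. -/
def IsResolventKernel {X : Type*} [MeasurableSpace X] (R : X → X → ℝ) (ν : Measure X) (α : ℝ)
    (u : X → X → ℝ) : Prop :=
  ∃ 𝓔 : ResistanceForm X, (∀ p q, 𝓔.resistance p q = R p q) ∧
    ∀ x, ∃ h : u x ∈ 𝓔.domain, ∀ f : 𝓔.domain,
      𝓔.form ⟨u x, h⟩ f + α * ∫ y, u x y * (f : X → ℝ) y ∂ν = (f : X → ℝ) x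

/-- The convergence `fₙ ↣ f` for functions `fₙ` on `Aₙ × Aₙ` and `f` on `A × A`: whenever
`xₙ, yₙ ∈ Aₙ` converge to `x, y ∈ A`, the values `fₙ(xₙ, yₙ)` converge to `f(x, y)`. -/
def KernelTendsto {B : Type*} [TopologicalSpace B] {An : ℕ → Set B} {A : Set B}
    (fn : ∀ n, An n → An n → ℝ) (f : A → A → ℝ) : Prop :=
  ∀ (x y : A) (xn yn : ∀ n, An n),
    Tendsto (fun n => (xn n : B)) atTop (𝓝 (x : B)) →
    Tendsto (fun n => (yn n : B)) atTop (𝓝 (y : B)) →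
    Tendsto (fun n => fn n (xn n) (yn n)) atTop (𝓝 (f x y))

/-- The restriction to the subset `A` of a measure on `B`, as a measure on the space `A`. -/
noncomputable def measureOn {B : Type*} [MeasurableSpace B] (A : Set B) (μ : Measure B) :
    Measure A :=
  μ.comap Subtype.val

/-! ### Symmetric nonnegative bilinear forms -/

section Form

variable {D : Type*} [AddCommGroup D] [Module ℝ D] {E : D →ₗ[ℝ] D →ₗ[ℝ] ℝ}

/-! Everything is expressed through the Green function `green R o x y`, which depends on `R` alone.
It reproduces increments: paired with `f` in the energy, it gives `f x - f o`. On a finite set this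
reproducing identity is polynomial in the conductances and the resistances, so it passes to limits.
The conductances are bounded by inverse resistances, and these stay bounded because the limit `R` is
a metric. Compactness then yields conductances for `R` (`exists_pullback`,
`isResistanceMetric_of_tendsto`).

A resistance metric yields a resistance form as the monotone limit of its energies on finite sets
(`traceForm_mono`, `toResistanceForm`). Testing the resolvent equation with constants and with Green
functions gives two relations in which only `R` and `ν` appear: `α ∫ u = 1`, and `u z = u x - α ∫
u(y) green R x y z` (`resolvent_mass`, `resolvent_eq`). They give uniqueness even between kernels
built from different forms (`resolvent_unique`), and they are stable: a function that nearly
satisfies both is uniformly close to the resolvent (`abs_resolvent_sub_le`).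

For the convergence, `u(x, ·)` is extended to a continuous `U` on `B`. By continuous convergence of
`Rn` and weak convergence of `μn`, `U` nearly satisfies the two relations on `An n` with pole `xn
n`. Stability then makes `un n (xn n)` uniformly close to `U`. No subsequence of the kernels has to
be extracted. -/

theorem form_sq_le (hs : ∀ f g, E f g = E g f) (hn : ∀ f, 0 ≤ E f f) (f g : D) :
    E f g ^ 2 ≤ E f f * E g g :=
  LinearMap.BilinForm.apply_sq_le_of_symm E hn ⟨fun x y => hs x y⟩ f g

theorem form_sub_self (hs : ∀ f g, E f g = E g f) (f g : D) :
    E (f - g) (f - g) = E f f - 2 * E f g + E g g := by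
  simp only [map_sub, LinearMap.sub_apply, hs g f]; ring

theorem form_add_self (hs : ∀ f g, E f g = E g f) (f g : D) :
    E (f + g) (f + g) = E f f + 2 * E f g + E g g := by
  simp only [map_add, LinearMap.add_apply, hs g f]; ring

theorem form_add_self_le (hs : ∀ f g, E f g = E g f) (hn : ∀ f, 0 ≤ E f f) (f g : D) :
    E (f + g) (f + g) ≤ 2 * E f f + 2 * E g g := by
  have := hn (f - g)
  rw [form_sub_self hs] at this
  rw [form_add_self hs]; linarith

/-- Convergence in energy implies convergence under a functional bounded by the energy. -/
theorem tendsto_of_sq_le {ι : Type*} {l : Filter ι} {ℓ : D →ₗ[ℝ] ℝ} {C : ℝ}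
    (hℓ : ∀ f, ℓ f ^ 2 ≤ C * E f f) {f : ι → D} {g : D}
    (h : Tendsto (fun n => E (f n - g) (f n - g)) l (𝓝 0)) :
    Tendsto (fun n => ℓ (f n)) l (𝓝 (ℓ g)) := by
  have h1 : Tendsto (fun n => ℓ (f n - g) ^ 2) l (𝓝 0) := by
    refine squeeze_zero (fun n => sq_nonneg _) (fun n => hℓ _) ?_
    simpa using h.const_mul C
  have h2 : Tendsto (fun n => |ℓ (f n - g)|) l (𝓝 0) := by
    have := (Real.continuous_sqrt.tendsto 0).comp h1
    simpa [Function.comp_def, Real.sqrt_sq_eq_abs] using this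
  have h3 := (tendsto_zero_iff_abs_tendsto_zero _).2 h2
  have h4 : Tendsto (fun n => ℓ (f n - g) + ℓ g) l (𝓝 (0 + ℓ g)) := h3.add_const _
  simpa using h4

/-- The Riesz representation theorem for a complete symmetric nonnegative form. -/
theorem exists_riesz (hs : ∀ f g, E f g = E g f) (hn : ∀ f, 0 ≤ E f f)
    (hc : ∀ f : ℕ → D, (∀ ε > 0, ∃ N, ∀ m ≥ N, ∀ n ≥ N, E (f m - f n) (f m - f n) < ε) →
      ∃ g : D, Tendsto (fun n => E (f n - g) (f n - g)) atTop (𝓝 0))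
    (ℓ : D →ₗ[ℝ] ℝ) {C : ℝ} (hℓ : ∀ f, ℓ f ^ 2 ≤ C * E f f) : ∃ h, ∀ f, E h f = ℓ f := by
  -- The representative is found by minimizing this functional, which avoids passing to the quotient
  -- by the null space of `E`.
  set J : D → ℝ := fun f => E f f - 2 * ℓ f with hJ
  have hbdd : BddBelow (Set.range J) := by
    refine ⟨-|C|, ?_⟩
    rintro _ ⟨f, rfl⟩
    have h1 : ℓ f ^ 2 ≤ |C| * E f f :=
      (hℓ f).trans (mul_le_mul_of_nonneg_right (le_abs_self C) (hn f))
    have h2 : |2 * ℓ f| ≤ E f f + |C| := by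
      apply abs_le_of_sq_le_sq
      · nlinarith [sq_nonneg (E f f - |C|)]
      · have := hn f; positivity
    have := le_abs_self (2 * ℓ f)
    simp only [hJ]; linarith
  set m := ⨅ f, J f with hm
  have hle : ∀ f, m ≤ J f := fun f => ciInf_le hbdd f
  have hex : ∀ n : ℕ, ∃ f, J f < m + 1 / (n + 1) := fun n =>
    exists_lt_of_ciInf_lt (lt_add_of_pos_right _ (by positivity))
  choose f hf using hex
  obtain ⟨g, hg⟩ := hc f (by
    intro ε hε
    obtain ⟨N, hN⟩ := exists_nat_one_div_lt (show (0 : ℝ) < ε / 4 by positivity)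
    refine ⟨N, fun a ha b hb => ?_⟩
    -- By the parallelogram identity a minimizing sequence is Cauchy; the linear terms cancel.
    have key : E (f a - f b) (f a - f b)
        = 2 * J (f a) + 2 * J (f b) - 4 * J ((1 / 2 : ℝ) • (f a + f b)) := by
      simp only [hJ, map_sub, map_add, map_smul, LinearMap.sub_apply, LinearMap.add_apply,
        LinearMap.smul_apply, smul_eq_mul, hs (f b) (f a)]
      ring
    have hmono : ∀ k : ℕ, N ≤ k → (1 : ℝ) / (k + 1) ≤ 1 / (N + 1) := fun k hk =>
      one_div_le_one_div_of_le (by positivity) (by exact_mod_cast Nat.succ_le_succ hk)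
    have := hf a; have := hf b; have := hmono a ha; have := hmono b hb
    have := hle ((1 / 2 : ℝ) • (f a + f b))
    rw [key]; linarith)
  refine ⟨g, fun v => ?_⟩
  have hlim : Tendsto (fun n => E v (f n)) atTop (𝓝 (E v g)) :=
    tendsto_of_sq_le (ℓ := E v) (C := E v v) (fun w => form_sq_le hs hn v w) hg
  have hquad : ∀ t : ℝ, 0 ≤ E v v * (t * t) + (2 * (E v g - ℓ v)) * t + 0 := by
    intro t
    have h1 : ∀ n : ℕ, -(1 / ((n : ℝ) + 1)) ≤
        E v v * (t * t) + (2 * (E v (f n) - ℓ v)) * t := by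
      intro n
      have h2 := hle (f n + t • v)
      have h3 := hf n
      have h4 : J (f n + t • v) = J (f n) + (E v v * (t * t) + (2 * (E v (f n) - ℓ v)) * t) := by
        simp only [hJ, map_add, map_smul, LinearMap.add_apply, LinearMap.smul_apply, smul_eq_mul,
          hs (f n) v]
        ring
      linarith
    have h5 : Tendsto (fun n : ℕ => -(1 / ((n : ℝ) + 1))) atTop (𝓝 (-0)) :=
      tendsto_one_div_add_atTop_nhds_zero_nat.neg
    have h6 := le_of_tendsto_of_tendsto' h5
      ((((hlim.sub_const (ℓ v)).const_mul 2).mul_const t).const_add (E v v * (t * t))) h1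
    simpa using h6
  -- A nonnegative quadratic without constant term has no linear term either.
  have hd := discrim_le_zero hquad
  simp only [discrim, mul_zero, sub_zero] at hd
  have : E v g - ℓ v = 0 := by nlinarith [sq_nonneg (E v g - ℓ v)]
  rw [hs]; linarith

end Form

/-! ### Effective resistances of abstract energy forms -/

/-- The Green function with pole `o` of a resistance function. -/
noncomputable def green {X : Type*} (R : X → X → ℝ) (o x y : X) : ℝ :=
  (R x o + R y o - R x y) / 2

section Resistance

variable {D X : Type*} [AddCommGroup D] [Module ℝ D] {E : D →ₗ[ℝ] D →ₗ[ℝ] ℝ}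
  {ev : D →ₗ[ℝ] X → ℝ} {R : X → X → ℝ}

/-- If `k` represents the functional `f ↦ f p - f q`, its energy is the effective resistance. -/
theorem sSup_ratio_eq (hs : ∀ f g, E f g = E g f) (hn : ∀ f, 0 ≤ E f f)
    (hz : ∀ f, IsConstFun (ev f) → E f f = 0) {p q : X} {k : D}
    (hk : ∀ f, E k f = ev f p - ev f q) :
    sSup {r : ℝ | ∃ f : D, ¬ IsConstFun (ev f) ∧ r = |ev f p - ev f q| ^ 2 / E f f} = E k k := by
  have hle : ∀ f, |ev f p - ev f q| ^ 2 / E f f ≤ E k k := by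
    intro f
    rw [sq_abs, ← hk]
    exact div_le_of_le_mul₀ (hn f) (hn k) (form_sq_le hs hn k f)
  -- If `k` has zero energy it may be constant and the set may be empty, where `sSup` is `0`;
  -- otherwise `k` attains the supremum.
  rcases eq_or_ne (E k k) 0 with h0 | h0
  · rw [h0]
    refine le_antisymm (Real.sSup_le ?_ le_rfl) (Real.sSup_nonneg ?_)
    · rintro r ⟨f, -, rfl⟩
      exact (hle f).trans h0.le
    · rintro r ⟨f, -, rfl⟩
      exact div_nonneg (by positivity) (hn f)
  · refine IsGreatest.csSup_eq ⟨⟨k, fun h => h0 (hz k h), ?_⟩, ?_⟩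
    · rw [← hk, sq_abs, sq, mul_div_assoc, div_self h0, mul_one]
    · rintro r ⟨f, -, rfl⟩
      exact hle f

theorem bddAbove_ratio (hs : ∀ f g, E f g = E g f) (hn : ∀ f, 0 ≤ E f f) {p q : X} {k : D}
    (hk : ∀ f, E k f = ev f p - ev f q) :
    BddAbove {r : ℝ | ∃ f : D, ¬ IsConstFun (ev f) ∧ r = |ev f p - ev f q| ^ 2 / E f f} := by
  refine ⟨E k k, ?_⟩
  rintro r ⟨f, -, rfl⟩
  rw [sq_abs, ← hk]
  exact div_le_of_le_mul₀ (hn f) (hn k) (form_sq_le hs hn k f)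

/-- Polarization: a potential is given by the resistance, up to a constant. -/
theorem potential_eq_green (hs : ∀ f g, E f g = E g f)
    (hR : ∀ p q k, (∀ f, E k f = ev f p - ev f q) → E k k = R p q)
    {o x y : X} {kx ky : D} (hx : ∀ f, E kx f = ev f x - ev f o)
    (hy : ∀ f, E ky f = ev f y - ev f o) : ev kx y - ev kx o = green R o x y := by
  have h1 := hR x o kx hx
  have h2 := hR y o ky hy
  have h3 := hR x y (kx - ky) (fun f => by
    rw [map_sub, LinearMap.sub_apply, hx, hy]; ring)
  rw [form_sub_self hs] at h3
  rw [green, ← h1, ← h2, ← h3, ← hy, hs]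
  ring

theorem resistance_self_self (hR : ∀ p q k, (∀ f, E k f = ev f p - ev f q) → E k k = R p q)
    (x : X) : R x x = 0 := by
  rw [← hR x x 0 (by simp)]; simp

end Resistance

/-! ### Conductances on finite sets -/

section Conductance

variable {V : Type*} [Fintype V]

/-- The bilinear form of the quadratic form `conductanceEnergy`. -/
noncomputable def conductanceForm (c : V → V → ℝ) : (V → ℝ) →ₗ[ℝ] (V → ℝ) →ₗ[ℝ] ℝ :=
  LinearMap.mk₂ ℝ (fun f g => (1 / 2) * ∑ x, ∑ y, c x y * ((f x - f y) * (g x - g y)))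
    (fun f f' g => by
      rw [← mul_add]; simp only [← Finset.sum_add_distrib, Pi.add_apply]
      congr 1; refine Finset.sum_congr rfl fun x _ => Finset.sum_congr rfl fun y _ => ?_; ring)
    (fun a f g => by
      simp only [smul_eq_mul, Finset.mul_sum, Pi.smul_apply]
      refine Finset.sum_congr rfl fun x _ => Finset.sum_congr rfl fun y _ => ?_; ring)
    (fun f g g' => by
      rw [← mul_add]; simp only [← Finset.sum_add_distrib, Pi.add_apply]
      congr 1; refine Finset.sum_congr rfl fun x _ => Finset.sum_congr rfl fun y _ => ?_; ring)
    (fun a f g => by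
      simp only [smul_eq_mul, Finset.mul_sum, Pi.smul_apply]
      refine Finset.sum_congr rfl fun x _ => Finset.sum_congr rfl fun y _ => ?_; ring)

theorem conductanceForm_apply (c : V → V → ℝ) (f g : V → ℝ) :
    conductanceForm c f g = (1 / 2) * ∑ x, ∑ y, c x y * ((f x - f y) * (g x - g y)) := rfl

theorem conductanceForm_self (c : V → V → ℝ) (f : V → ℝ) :
    conductanceForm c f f = conductanceEnergy c f := by
  simp only [conductanceForm_apply, conductanceEnergy, sq]

theorem conductanceForm_symm (c : V → V → ℝ) (f g : V → ℝ) :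
    conductanceForm c f g = conductanceForm c g f := by
  simp only [conductanceForm_apply, mul_comm (f _ - f _)]

theorem conductanceForm_self_nonneg {c : V → V → ℝ} (hc : ∀ x y, 0 ≤ c x y) (f : V → ℝ) :
    0 ≤ conductanceForm c f f := by
  rw [conductanceForm_apply]
  refine mul_nonneg (by norm_num) (Finset.sum_nonneg fun x _ => Finset.sum_nonneg fun y _ =>
    mul_nonneg (hc x y) (mul_self_nonneg _))

theorem conductanceForm_eq_zero_of_isConstFun (c : V → V → ℝ) {f : V → ℝ} (hf : IsConstFun f)
    (g : V → ℝ) : conductanceForm c f g = 0 := by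
  obtain ⟨a, ha⟩ := hf
  simp [conductanceForm_apply, ha]

/-- Summation by parts. -/
theorem conductanceForm_eq_sum {c : V → V → ℝ} (hc : ∀ x y, c x y = c y x) (f g : V → ℝ) :
    conductanceForm c f g = ∑ x, (∑ y, c x y * (f x - f y)) * g x := by
  have h1 : ∑ x, ∑ y, c x y * ((f x - f y) * (g x - g y))
      = ∑ x, ∑ y, c x y * (f x - f y) * g x - ∑ x, ∑ y, c x y * (f x - f y) * g y := by
    simp only [← Finset.sum_sub_distrib]
    refine Finset.sum_congr rfl fun x _ => Finset.sum_congr rfl fun y _ => ?_; ring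
  have h2 : ∑ x, ∑ y, c x y * (f x - f y) * g y
      = - ∑ x, ∑ y, c x y * (f x - f y) * g x := by
    rw [Finset.sum_comm]
    simp only [← Finset.sum_neg_distrib]
    refine Finset.sum_congr rfl fun x _ => Finset.sum_congr rfl fun y _ => ?_
    rw [hc y x]; ring
  rw [conductanceForm_apply, h1, h2]
  simp only [Finset.sum_mul]
  ring

theorem sum_laplacian_eq_zero {c : V → V → ℝ} (hc : ∀ x y, c x y = c y x) (f : V → ℝ) :
    ∑ x, ∑ y, c x y * (f x - f y) = 0 := by
  have h := conductanceForm_eq_sum hc f (fun _ => 1)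
  rw [conductanceForm_symm, conductanceForm_eq_zero_of_isConstFun c ⟨1, fun _ => rfl⟩] at h
  simpa using h.symm

theorem conductanceForm_markov {c : V → V → ℝ} (hc : ∀ x y, 0 ≤ c x y) {f g : V → ℝ}
    (h : ∀ x y, |g x - g y| ≤ |f x - f y|) : conductanceForm c g g ≤ conductanceForm c f f := by
  simp only [conductanceForm_apply]
  refine mul_le_mul_of_nonneg_left (Finset.sum_le_sum fun x _ => Finset.sum_le_sum fun y _ =>
    mul_le_mul_of_nonneg_left ?_ (hc x y)) (by norm_num)
  have := sq_le_sq.2 (h x y)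
  nlinarith

/-- In finite dimension the range of the form is the annihilator of its kernel. The kernel consists
of constants, which increments annihilate. -/
theorem IsConductance.exists_potential {c : V → V → ℝ} (hc : IsConductance c) (p q : V) :
    ∃ k, ∀ f, conductanceForm c k f = f p - f q := by
  let ℓ : Module.Dual ℝ (V → ℝ) :=
    (LinearMap.proj p : (V → ℝ) →ₗ[ℝ] ℝ) - (LinearMap.proj q : (V → ℝ) →ₗ[ℝ] ℝ)
  have hmem : ℓ ∈ LinearMap.range (conductanceForm c) := by
    rw [← Subspace.dualCoannihilator_dualAnnihilator_eq
      (W := LinearMap.range (conductanceForm c)), Submodule.mem_dualAnnihilator]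
    intro f hf
    rw [Submodule.mem_dualCoannihilator] at hf
    obtain ⟨a, ha⟩ := (hc.energy_eq_zero_iff f).1
      ((conductanceForm_self c f).symm.trans (hf _ ⟨f, rfl⟩))
    simp [ℓ, ha]
  obtain ⟨k, hk⟩ := hmem
  exact ⟨k, fun f => by rw [hk]; rfl⟩

theorem IsConductance.form_self_eq_resistance {c : V → V → ℝ} (hc : IsConductance c) (p q : V)
    (k : V → ℝ) (hk : ∀ f, conductanceForm c k f = f p - f q) :
    conductanceForm c k k = conductanceResistance c p q := by
  rw [← sSup_ratio_eq (E := conductanceForm c) (ev := LinearMap.id) (conductanceForm_symm c)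
    (conductanceForm_self_nonneg hc.nonneg)
    (fun f hf => conductanceForm_eq_zero_of_isConstFun c hf f) hk]
  simp only [conductanceForm_self]
  rfl

/-- The Green function of the effective resistance reproduces increments of functions. -/
theorem IsConductance.form_green {c : V → V → ℝ} (hc : IsConductance c) (o x : V) (f : V → ℝ) :
    conductanceForm c (green (conductanceResistance c) o x) f = f x - f o := by
  obtain ⟨kx, hx⟩ := hc.exists_potential x o
  have h : (kx - green (conductanceResistance c) o x) = fun _ => kx o := by
    funext y
    obtain ⟨ky, hy⟩ := hc.exists_potential y o
    have := potential_eq_green (E := conductanceForm c) (ev := LinearMap.id)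
      (conductanceForm_symm c) hc.form_self_eq_resistance hx hy
    simp only [LinearMap.id_apply] at this
    rw [Pi.sub_apply, ← this]; ring
  have h2 := conductanceForm_eq_zero_of_isConstFun c (f := kx - green (conductanceResistance c) o x)
    ⟨kx o, fun y => by rw [h]⟩ f
  rw [map_sub, LinearMap.sub_apply, hx] at h2
  linarith

theorem IsConductance.resistance_self {c : V → V → ℝ} (hc : IsConductance c) (x : V) :
    conductanceResistance c x x = 0 :=
  resistance_self_self (E := conductanceForm c) (ev := LinearMap.id) hc.form_self_eq_resistance x

theorem IsConductance.resistance_nonneg {c : V → V → ℝ} (hc : IsConductance c) (x y : V) :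
    0 ≤ conductanceResistance c x y := by
  obtain ⟨k, hk⟩ := hc.exists_potential x y
  rw [← hc.form_self_eq_resistance x y k hk]
  exact conductanceForm_self_nonneg hc.nonneg k

/-- Cauchy–Schwarz against the Green function, whose energy is `R x o`. -/
theorem sub_sq_le_of_green {c : V → V → ℝ} (hc : ∀ x y, 0 ≤ c x y) {R : V → V → ℝ}
    (h0 : ∀ x, R x x = 0) (o x : V)
    (hg : ∀ f, conductanceForm c (green R o x) f = f x - f o) (f : V → ℝ) :
    (f x - f o) ^ 2 ≤ R x o * conductanceForm c f f := by
  rw [← hg f]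
  refine (form_sq_le (conductanceForm_symm c) (conductanceForm_self_nonneg hc) _ _).trans_eq ?_
  rw [hg]; simp [green, h0]

/-- Conductances are determined by the reproducing property of the Green function. -/
theorem isConductance_of_green {c : V → V → ℝ} (hs : ∀ x y, c x y = c y x)
    (hc : ∀ x y, 0 ≤ c x y) {R : V → V → ℝ} (h0 : ∀ x, R x x = 0)
    (hg : ∀ o x f, conductanceForm c (green R o x) f = f x - f o) : IsConductance c where
  symm := hs
  nonneg := hc
  energy_eq_zero_iff f := by
    rw [← conductanceForm_self]
    refine ⟨fun h => ?_, fun h => conductanceForm_eq_zero_of_isConstFun c h f⟩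
    rcases isEmpty_or_nonempty V with hV | ⟨⟨o⟩⟩
    · exact ⟨0, fun x => hV.elim x⟩
    · refine ⟨f o, fun x => ?_⟩
      have := sub_sq_le_of_green hc h0 o x (hg o x) f
      rw [h, mul_zero] at this
      have := pow_eq_zero_iff (two_ne_zero) |>.1 (le_antisymm this (sq_nonneg _))
      linarith

theorem conductanceResistance_eq_of_green {c : V → V → ℝ} (hs : ∀ x y, c x y = c y x)
    (hc : ∀ x y, 0 ≤ c x y) {R : V → V → ℝ} (h0 : ∀ x, R x x = 0)
    (hg : ∀ o x f, conductanceForm c (green R o x) f = f x - f o) (x y : V) :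
    conductanceResistance c x y = R x y := by
  rw [← (isConductance_of_green hs hc h0 hg).form_self_eq_resistance x y _ (hg y x), hg]
  simp [green, h0]

end Conductance

/-! ### Resistance metrics -/

namespace IsResistanceMetric

variable {X : Type*} {R : X → X → ℝ}

/-- Replaces the supremum in the definition by an identity that is stable under limits. -/
theorem exists_green (hR : IsResistanceMetric R) (V : Finset X) :
    ∃ c : V → V → ℝ, (∀ x y, c x y = c y x) ∧ (∀ x y, 0 ≤ c x y) ∧
      ∀ (o x : V) (f : V → ℝ), conductanceForm c (fun y : V => green R o x y) f = f x - f o := by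
  obtain ⟨c, hc, h⟩ := hR V
  refine ⟨c, hc.symm, hc.nonneg, fun o x f => ?_⟩
  rw [← hc.form_green o x f]
  congr 1
  simp only [green, h]
  rfl

theorem self (hR : IsResistanceMetric R) (x : X) : R x x = 0 := by
  obtain ⟨c, hc, h⟩ := hR {x}
  have := h ⟨x, by simp⟩ ⟨x, by simp⟩
  rw [hc.resistance_self] at this
  exact this

theorem nonneg (hR : IsResistanceMetric R) (x y : X) : 0 ≤ R x y := by
  classical
  obtain ⟨c, hc, h⟩ := hR {x, y}
  have h1 := h ⟨x, by simp⟩ ⟨y, by simp⟩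
  rw [show R x y = _ from h1]
  exact hc.resistance_nonneg _ _

/-- A resistance metric pulls back along an injection of a finite type to the effective
resistance of conductances which are bounded by the inverse resistance. -/
theorem exists_pullback (hR : IsResistanceMetric R) {V : Type*} [Fintype V] {φ : V → X}
    (hφ : Function.Injective φ) :
    ∃ c : V → V → ℝ, (∀ x y, c x y = c y x) ∧ (∀ x y, 0 ≤ c x y) ∧
      (∀ x y, c x y ≤ (R (φ x) (φ y))⁻¹) ∧
      ∀ (o x : V) (f : V → ℝ),
        conductanceForm c (fun y => green R (φ o) (φ x) (φ y)) f = f x - f o := by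
  classical
  obtain ⟨c, hs, hn, hg⟩ := hR.exists_green (Finset.univ.map ⟨φ, hφ⟩)
  let e : V ≃ (Finset.univ.map ⟨φ, hφ⟩ : Finset X) :=
    Equiv.ofBijective (fun v => ⟨φ v, by simp⟩) ⟨fun a b h => hφ (by simpa using h), by
      rintro ⟨x, hx⟩
      obtain ⟨v, -, rfl⟩ := Finset.mem_map.1 hx
      exact ⟨v, rfl⟩⟩
  have hev : ∀ v, (e v : X) = φ v := fun v => rfl
  -- Diagonal conductances do not affect the energy; they are set to `0` because the bound there
  -- reads `0⁻¹ = 0`.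
  let c' : V → V → ℝ := fun x y => if x = y then 0 else c (e x) (e y)
  have hform : ∀ f g : V → ℝ,
      conductanceForm c' f g = conductanceForm c (f ∘ e.symm) (g ∘ e.symm) := by
    intro f g
    simp only [conductanceForm_apply]
    rw [← Equiv.sum_comp e]
    congr 1
    refine Finset.sum_congr rfl fun x _ => ?_
    rw [← Equiv.sum_comp e]
    refine Finset.sum_congr rfl fun y _ => ?_
    by_cases hxy : x = y
    · subst hxy; simp
    · simp [c', hxy]
  have hs' : ∀ x y, c' x y = c' y x := fun x y => by
    simp only [c', eq_comm (a := x) (b := y), hs (e x) (e y)]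
  have hn' : ∀ x y, 0 ≤ c' x y := fun x y => by
    simp only [c']; split_ifs; exacts [le_rfl, hn _ _]
  have hg' : ∀ (o x : V) (f : V → ℝ),
      conductanceForm c' (fun y => green R (φ o) (φ x) (φ y)) f = f x - f o := by
    intro o x f
    rw [hform]
    have := hg (e o) (e x) (f ∘ e.symm)
    simp only [Function.comp_apply, Equiv.symm_apply_apply] at this
    rw [← this]
    congr 1
    congr 1
    funext y
    simp only [Function.comp_apply, ← hev, Equiv.apply_symm_apply]
  refine ⟨c', hs', hn', fun x y => ?_, hg'⟩
  by_cases hxy : x = y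
  · simp [c', hxy, hR.self]
  -- Both the energy of `k` and its increment across the edge equal the resistance `r`. The energy
  -- of that edge alone is `c' x y * r ^ 2 ≤ r`; its two orientations absorb the factor `1 / 2`.
  set k : V → ℝ := fun z => green R (φ y) (φ x) (φ z) with hk
  have hkxy : k x - k y = R (φ x) (φ y) := by
    simp only [hk, green, hR.self]; ring
  have h1 : c' x y * (k x - k y) ^ 2 ≤ conductanceForm c' k k := by
    have hterm : ∀ a b, 0 ≤ c' a b * ((k a - k b) * (k a - k b)) := fun a b =>
      mul_nonneg (hn' a b) (mul_self_nonneg _)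
    have hxle : c' x y * ((k x - k y) * (k x - k y)) ≤ ∑ b, c' x b * ((k x - k b) * (k x - k b)) :=
      Finset.single_le_sum (f := fun b => c' x b * ((k x - k b) * (k x - k b)))
        (fun b _ => hterm x b) (Finset.mem_univ y)
    have hyle : c' y x * ((k y - k x) * (k y - k x)) ≤ ∑ b, c' y b * ((k y - k b) * (k y - k b)) :=
      Finset.single_le_sum (f := fun b => c' y b * ((k y - k b) * (k y - k b)))
        (fun b _ => hterm y b) (Finset.mem_univ x)
    have hpair := Finset.add_le_sum (s := Finset.univ)
      (f := fun a => ∑ b, c' a b * ((k a - k b) * (k a - k b)))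
      (fun a _ => Finset.sum_nonneg fun b _ => hterm a b) (Finset.mem_univ x) (Finset.mem_univ y) hxy
    rw [hs' y x] at hyle
    rw [conductanceForm_apply]
    nlinarith
  rw [hg' y x k, hkxy] at h1
  -- Zero resistance is impossible, since an indicator function separates the two points.
  rcases (hR.nonneg (φ x) (φ y)).eq_or_lt with h | h
  · exfalso
    have := sub_sq_le_of_green (R := fun a b => R (φ a) (φ b)) hn' (fun a => hR.self _) y x
      (fun f => hg' y x f) (fun z => if z = x then 1 else 0)
    rw [← h, zero_mul] at this
    simp [Ne.symm hxy] at this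
    linarith
  · rw [← one_div, le_div_iff₀ h]
    nlinarith

end IsResistanceMetric

/-- A pointwise limit of resistance metrics that is a metric is a resistance metric. -/
theorem isResistanceMetric_of_tendsto {ι X : Type*} {l : Filter ι} {Y : ι → Type*}
    {Rn : ∀ i, Y i → Y i → ℝ} (hRn : ∀ i, IsResistanceMetric (Rn i)) [l.NeBot] {R : X → X → ℝ} (hR : IsMetricOn R) (φ : ∀ i, X → Y i)
    (hφ : ∀ x y, Tendsto (fun i => Rn i (φ i x) (φ i y)) l (𝓝 (R x y))) :
    IsResistanceMetric R := by
  intro V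
  have hpos : ∀ x y : V, x ≠ y → 0 < R x y := fun x y h =>
    (hR.nonneg x y).lt_of_ne' fun h0 => h (Subtype.ext ((hR.eq_zero_iff _ _).1 h0))
  have h0 : ∀ x : V, R x x = 0 := fun x => (hR.eq_zero_iff _ _).2 rfl
  have hev : ∀ᶠ i in l, ∀ x y : V, x ≠ y → R x y / 2 < Rn i (φ i x) (φ i y) := by
    refine eventually_all.2 fun x => eventually_all.2 fun y => ?_
    by_cases hxy : x = y
    · exact Eventually.of_forall fun _ h => absurd hxy h
    · filter_upwards [(hφ x y).eventually (lt_mem_nhds (half_lt_self (hpos x y hxy)))] with i hi _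
        using hi
  -- A compact box containing the approximating conductances, as their resistances eventually exceed
  -- `R x y / 2`. On the diagonal `2 / 0 = 0`.
  let K : Set (V → V → ℝ) := Set.Icc 0 (fun x y => 2 / R x y)
  have hex : ∀ᶠ i in l, ∃ c ∈ K, (∀ x y, c x y = c y x) ∧ ∀ (o x : V) (f : V → ℝ),
      conductanceForm c (fun y => green (Rn i) (φ i o) (φ i x) (φ i y)) f = f x - f o := by
    filter_upwards [hev] with i hi
    have hinj : Function.Injective (fun v : V => φ i v) := by
      intro x y hxy
      by_contra hne
      have h1 := hi x y hne
      simp only at hxy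
      rw [hxy, (hRn i).self] at h1
      linarith [hpos x y hne]
    obtain ⟨c, hs, hn, hle, hg⟩ := (hRn i).exists_pullback hinj
    refine ⟨c, ⟨fun x y => hn x y, fun x y => (hle x y).trans ?_⟩, hs, hg⟩
    by_cases hxy : x = y
    · simp [hxy, (hRn i).self, h0]
    · change _ ≤ 2 / R x y
      rw [← one_div_div, ← one_div]
      exact one_div_le_one_div_of_le (half_pos (hpos x y hxy)) (hi x y hxy).le
  classical
  let c : ι → V → V → ℝ := fun i => if h : _ then (Classical.choose (p := fun c : V → V → ℝ =>
    c ∈ K ∧ (∀ x y, c x y = c y x) ∧ ∀ (o x : V) (f : V → ℝ),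
      conductanceForm c (fun y => green (Rn i) (φ i o) (φ i x) (φ i y)) f = f x - f o) h) else 0
  have hc : ∀ᶠ i in l, c i ∈ K ∧ (∀ x y, c i x y = c i y x) ∧ ∀ (o x : V) (f : V → ℝ),
      conductanceForm (c i) (fun y => green (Rn i) (φ i o) (φ i x) (φ i y)) f = f x - f o := by
    filter_upwards [hex] with i hi
    simp only [c, dif_pos hi]
    exact Classical.choose_spec hi
  have hK : IsCompact K := isCompact_Icc
  obtain ⟨F, hF⟩ := Ultrafilter.exists_le l
  obtain ⟨c₀, hc₀, hlim⟩ := hK.ultrafilter_le_nhds (F.map c)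
    (le_principal_iff.2 (hF (hc.mono fun i hi => hi.1)))
  have hlim' : Tendsto c F (𝓝 c₀) := hlim
  have hlimxy : ∀ x y, Tendsto (fun i => c i x y) F (𝓝 (c₀ x y)) := fun x y =>
    (tendsto_pi_nhds.1 ((tendsto_pi_nhds.1 hlim') x)) y
  have hcF := hF hc
  have hs : ∀ x y, c₀ x y = c₀ y x := fun x y =>
    tendsto_nhds_unique_of_eventuallyEq (hlimxy x y) (hlimxy y x)
      (by filter_upwards [hcF] with i hi using hi.2.1 x y)
  have hn : ∀ x y, 0 ≤ c₀ x y := fun x y => hc₀.1 x y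
  have hg : ∀ (o x : V) (f : V → ℝ),
      conductanceForm c₀ (green (fun a b : V => R a b) o x) f = f x - f o := by
    intro o x f
    have hgl : ∀ y : V, Tendsto (fun i => green (Rn i) (φ i o) (φ i x) (φ i y)) F
        (𝓝 (green (fun a b : V => R a b) o x y)) := fun y =>
      ((((hφ x o).add (hφ y o)).sub (hφ x y)).div_const 2).mono_left hF
    have : Tendsto (fun i => conductanceForm (c i)
        (fun y => green (Rn i) (φ i o) (φ i x) (φ i y)) f) F
        (𝓝 (conductanceForm c₀ (green (fun a b : V => R a b) o x) f)) := by
      simp only [conductanceForm_apply]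
      refine Tendsto.const_mul _ (tendsto_finsetSum _ fun a _ => tendsto_finsetSum _ fun b _ => ?_)
      exact (hlimxy a b).mul (((hgl a).sub (hgl b)).mul_const _)
    refine tendsto_nhds_unique_of_eventuallyEq this tendsto_const_nhds ?_
    filter_upwards [hcF] with i hi using hi.2.2 o x f
  exact ⟨c₀, isConductance_of_green hs hn h0 hg, fun x y =>
    (conductanceResistance_eq_of_green hs hn h0 hg x y).symm⟩

/-! ### The resistance form of a resistance metric -/

namespace IsResistanceMetric

variable {X : Type*} {R : X → X → ℝ}

/-- The energy, on functions on `X`, of the restriction to the finite set `V`. -/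
noncomputable def traceForm (hR : IsResistanceMetric R) (V : Finset X) :
    (X → ℝ) →ₗ[ℝ] (X → ℝ) →ₗ[ℝ] ℝ :=
  (conductanceForm (hR.exists_green V).choose).compl₁₂
    (LinearMap.funLeft ℝ ℝ Subtype.val) (LinearMap.funLeft ℝ ℝ Subtype.val)

variable (hR : IsResistanceMetric R)

theorem traceForm_apply (V : Finset X) (f g : X → ℝ) :
    hR.traceForm V f g =
      conductanceForm (hR.exists_green V).choose (fun v => f v) (fun v => g v) := rfl

theorem traceForm_symm (V : Finset X) (f g : X → ℝ) : hR.traceForm V f g = hR.traceForm V g f :=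
  conductanceForm_symm _ _ _

theorem traceForm_nonneg (V : Finset X) (f : X → ℝ) : 0 ≤ hR.traceForm V f f :=
  conductanceForm_self_nonneg (hR.exists_green V).choose_spec.2.1 _

theorem traceForm_green {V : Finset X} {o x : X} (ho : o ∈ V) (hx : x ∈ V) (f : X → ℝ) :
    hR.traceForm V (green R o x) f = f x - f o :=
  (hR.exists_green V).choose_spec.2.2 ⟨o, ho⟩ ⟨x, hx⟩ (fun v => f v)

theorem traceForm_eq_zero (V : Finset X) {f : X → ℝ} (hf : IsConstFun f) (g : X → ℝ) :
    hR.traceForm V f g = 0 :=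
  conductanceForm_eq_zero_of_isConstFun _ (hf.imp fun _ h v => h v) _

theorem sub_sq_le_traceForm {V : Finset X} {o x : X} (ho : o ∈ V) (hx : x ∈ V) (f : X → ℝ) :
    (f x - f o) ^ 2 ≤ R x o * hR.traceForm V f f := by
  rw [← hR.traceForm_green ho hx f]
  refine (form_sq_le (hR.traceForm_symm V) (hR.traceForm_nonneg V) _ _).trans_eq ?_
  rw [hR.traceForm_green ho hx]; simp [green, hR.self]

/-- The harmonic extension of a function on a finite set. -/
theorem exists_harmonic {V : Finset X} {o : X} (ho : o ∈ V) (f : X → ℝ) :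
    ∃ h : X → ℝ, ∀ W, V ⊆ W → ∀ g, hR.traceForm W h g = hR.traceForm V f g := by
  obtain ⟨hs, -, -⟩ := (hR.exists_green V).choose_spec
  set c := (hR.exists_green V).choose
  -- The net currents of `f`. Superposing Green functions with these weights gives `h`; the terms at
  -- the pole cancel because the currents sum to zero.
  let a : V → ℝ := fun x => ∑ y : V, c x y * (f x - f y)
  refine ⟨∑ x : V, a x • green R o x, fun W hW g => ?_⟩
  rw [hR.traceForm_apply V f g, conductanceForm_eq_sum hs]
  simp only [map_sum, LinearMap.sum_apply, map_smul, LinearMap.smul_apply, smul_eq_mul]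
  have h0 : ∑ x : V, a x * g o = 0 := by
    rw [← Finset.sum_mul, sum_laplacian_eq_zero hs (fun v : V => f v), zero_mul]
  refine (Finset.sum_congr rfl fun x _ => ?_ :
    _ = ∑ x : V, (a x * g x - a x * g o)).trans ?_
  · rw [hR.traceForm_green (hW ho) (hW x.2), mul_sub]
  · rw [Finset.sum_sub_distrib, h0, sub_zero]

theorem traceForm_empty (f : X → ℝ) : hR.traceForm ∅ f f = 0 := by
  simp [traceForm_apply, conductanceForm_apply]

/-- The harmonic extension `h` has the same energy on `W` as `f` on `V`, and so has its pairing with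
`f` on `W`. Cauchy–Schwarz on `W` then compares the two energies of `f`. -/
theorem traceForm_mono (f : X → ℝ) : Monotone fun V => hR.traceForm V f f := by
  intro V W hVW
  simp only
  rcases V.eq_empty_or_nonempty with rfl | ⟨o, ho⟩
  · rw [traceForm_empty]; exact hR.traceForm_nonneg W f
  obtain ⟨h, hh⟩ := hR.exists_harmonic ho f
  have h1 := form_sq_le (hR.traceForm_symm W) (hR.traceForm_nonneg W) h f
  rw [hh W hVW, hh W hVW, hR.traceForm_symm V f h, hh V subset_rfl] at h1
  have h2 := hR.traceForm_nonneg V f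
  by_contra! hlt
  nlinarith [hR.traceForm_nonneg W f]

/-- The functions of finite energy. -/
def energyDomain : Submodule ℝ (X → ℝ) where
  carrier := {f | BddAbove (Set.range fun V => hR.traceForm V f f)}
  zero_mem' := ⟨0, by rintro _ ⟨V, rfl⟩; simp⟩
  add_mem' := by
    rintro f g ⟨a, ha⟩ ⟨b, hb⟩
    refine ⟨2 * a + 2 * b, ?_⟩
    rintro _ ⟨V, rfl⟩
    have h1 : hR.traceForm V f f ≤ a := ha ⟨V, rfl⟩
    have h2 : hR.traceForm V g g ≤ b := hb ⟨V, rfl⟩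
    have := form_add_self_le (hR.traceForm_symm V) (hR.traceForm_nonneg V) f g
    simp only; linarith
  smul_mem' := by
    rintro t f ⟨a, ha⟩
    refine ⟨t * (t * a), ?_⟩
    rintro _ ⟨V, rfl⟩
    have h1 : hR.traceForm V f f ≤ a := ha ⟨V, rfl⟩
    simp only [map_smul, LinearMap.smul_apply, smul_eq_mul]
    nlinarith [mul_self_nonneg t]

theorem mem_energyDomain {f : X → ℝ} {a : ℝ} (h : ∀ V, hR.traceForm V f f ≤ a) :
    f ∈ hR.energyDomain :=
  ⟨a, by rintro _ ⟨V, rfl⟩; exact h V⟩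

/-- The mixed terms need not be monotone, but polarization reduces them to three monotone bounded
nets. -/
theorem exists_tendsto_traceForm (f g : hR.energyDomain) :
    ∃ a, Tendsto (fun V => hR.traceForm V f g) atTop (𝓝 a) := by
  have h1 := tendsto_atTop_ciSup (hR.traceForm_mono (f + g : hR.energyDomain)) (f + g).2
  have h2 := tendsto_atTop_ciSup (hR.traceForm_mono f) f.2
  have h3 := tendsto_atTop_ciSup (hR.traceForm_mono g) g.2
  refine ⟨_, (((h1.sub h2).sub h3).div_const 2).congr fun V => ?_⟩
  have := form_add_self (hR.traceForm_symm V) (f : X → ℝ) g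
  rw [Submodule.coe_add, this]
  ring

/-- The energy, as the limit of the energies of the restrictions to finite sets. -/
noncomputable def energyForm : hR.energyDomain →ₗ[ℝ] hR.energyDomain →ₗ[ℝ] ℝ :=
  LinearMap.mk₂ ℝ (fun f g => (hR.exists_tendsto_traceForm f g).choose)
    (fun f f' g => tendsto_nhds_unique (hR.exists_tendsto_traceForm (f + f') g).choose_spec
      (((hR.exists_tendsto_traceForm f g).choose_spec.add
        (hR.exists_tendsto_traceForm f' g).choose_spec).congr fun V => by simp))
    (fun a f g => tendsto_nhds_unique (hR.exists_tendsto_traceForm (a • f) g).choose_spec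
      (((hR.exists_tendsto_traceForm f g).choose_spec.const_mul a).congr fun V => by simp))
    (fun f g g' => tendsto_nhds_unique (hR.exists_tendsto_traceForm f (g + g')).choose_spec
      (((hR.exists_tendsto_traceForm f g).choose_spec.add
        (hR.exists_tendsto_traceForm f g').choose_spec).congr fun V => by simp))
    (fun a f g => tendsto_nhds_unique (hR.exists_tendsto_traceForm f (a • g)).choose_spec
      (((hR.exists_tendsto_traceForm f g).choose_spec.const_mul a).congr fun V => by simp))

theorem tendsto_traceForm (f g : hR.energyDomain) :
    Tendsto (fun V => hR.traceForm V f g) atTop (𝓝 (hR.energyForm f g)) :=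
  (hR.exists_tendsto_traceForm f g).choose_spec

theorem traceForm_le_energyForm (V : Finset X) (f : hR.energyDomain) :
    hR.traceForm V f f ≤ hR.energyForm f f :=
  (hR.traceForm_mono f).ge_of_tendsto (hR.tendsto_traceForm f f) V

theorem energyForm_le {f : hR.energyDomain} {a : ℝ} (h : ∀ V, hR.traceForm V f f ≤ a) :
    hR.energyForm f f ≤ a :=
  le_of_tendsto' (hR.tendsto_traceForm f f) h

theorem energyForm_symm (f g : hR.energyDomain) : hR.energyForm f g = hR.energyForm g f :=
  tendsto_nhds_unique (hR.tendsto_traceForm f g)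
    ((hR.tendsto_traceForm g f).congr fun V => hR.traceForm_symm V g f)

theorem energyForm_nonneg (f : hR.energyDomain) : 0 ≤ hR.energyForm f f :=
  (hR.traceForm_nonneg ∅ f).trans (hR.traceForm_le_energyForm ∅ f)

theorem sub_sq_le_energyForm (o x : X) (f : hR.energyDomain) :
    ((f : X → ℝ) x - (f : X → ℝ) o) ^ 2 ≤ R x o * hR.energyForm f f := by
  classical
  refine (hR.sub_sq_le_traceForm (V := {o, x}) (by simp) (by simp) f).trans ?_
  exact mul_le_mul_of_nonneg_left (hR.traceForm_le_energyForm _ f) (hR.nonneg x o)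

theorem energyForm_eq_of_eventually {f g : hR.energyDomain} {a : ℝ} (V : Finset X)
    (h : ∀ W, V ⊆ W → hR.traceForm W f g = a) : hR.energyForm f g = a :=
  tendsto_nhds_unique (hR.tendsto_traceForm f g)
    (tendsto_const_nhds.congr' ((eventually_ge_atTop V).mono fun W hW => (h W hW).symm))

theorem mem_energyDomain_of_eventually {f : X → ℝ} {a : ℝ} (V : Finset X)
    (h : ∀ W, V ⊆ W → hR.traceForm W f f ≤ a) : f ∈ hR.energyDomain := by
  classical
  exact hR.mem_energyDomain (a := a) fun W =>
    (hR.traceForm_mono f Finset.subset_union_right).trans (h (V ∪ W) Finset.subset_union_left)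

/-- The Green function reproduces increments on every finite set containing `p` and `q`, so the nets
defining its energies are eventually constant. -/
theorem exists_energyForm_potential (p q : X) :
    ∃ k : hR.energyDomain, (∀ f : hR.energyDomain,
      hR.energyForm k f = (f : X → ℝ) p - (f : X → ℝ) q) ∧ hR.energyForm k k = R p q := by
  classical
  have h : ∀ W : Finset X, {q, p} ⊆ W → ∀ f, hR.traceForm W (green R q p) f = f p - f q :=
    fun W hW f => hR.traceForm_green (hW (by simp)) (hW (by simp)) f
  let k : hR.energyDomain :=
    ⟨green R q p, hR.mem_energyDomain_of_eventually {q, p} fun W hW => (h W hW _).le⟩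
  have hk : ∀ f : hR.energyDomain, hR.energyForm k f = (f : X → ℝ) p - (f : X → ℝ) q :=
    fun f => hR.energyForm_eq_of_eventually {q, p} fun W hW => h W hW f
  refine ⟨k, hk, ?_⟩
  rw [hk]
  simp [k, green, hR.self]

theorem const_mem_energyDomain (a : ℝ) : (fun _ => a) ∈ hR.energyDomain :=
  hR.mem_energyDomain (a := 0) fun V => (hR.traceForm_eq_zero V ⟨a, fun _ => rfl⟩ _).le

theorem energyForm_self_eq_zero_iff (f : hR.energyDomain) :
    hR.energyForm f f = 0 ↔ IsConstFun (f : X → ℝ) := by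
  refine ⟨fun h => ?_, fun h => hR.energyForm_eq_of_eventually ∅
    fun W _ => hR.traceForm_eq_zero W h _⟩
  rcases isEmpty_or_nonempty X with hX | ⟨⟨o⟩⟩
  · exact ⟨0, fun x => hX.elim x⟩
  refine ⟨(f : X → ℝ) o, fun x => ?_⟩
  have := hR.sub_sq_le_energyForm o x f
  rw [h, mul_zero] at this
  have := pow_eq_zero_iff two_ne_zero |>.1 (le_antisymm this (sq_nonneg _))
  linarith

/-- After normalization at `o`, the resistance estimate gives a pointwise limit. Each trace energy
sees finitely many values, so the Cauchy bounds pass to the limit uniformly in `V`, and then to the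
supremum. -/
theorem energyForm_complete (f : ℕ → hR.energyDomain)
    (hf : ∀ ε > 0, ∃ N, ∀ m ≥ N, ∀ n ≥ N, hR.energyForm (f m - f n) (f m - f n) < ε) :
    ∃ g : hR.energyDomain, Tendsto (fun n => hR.energyForm (f n - g) (f n - g)) atTop (𝓝 0) := by
  rcases isEmpty_or_nonempty X with hX | ⟨⟨o⟩⟩
  · exact ⟨0, by simp [(hR.energyForm_self_eq_zero_iff _).2 ⟨0, fun x => hX.elim x⟩]⟩
  let F : ℕ → X → ℝ := fun n x => (f n : X → ℝ) x - (f n : X → ℝ) o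
  have hcau : ∀ x, ∃ a, Tendsto (fun n => F n x) atTop (𝓝 a) := by
    intro x
    refine cauchySeq_tendsto_of_complete (Metric.cauchySeq_iff.2 fun ε hε => ?_)
    have hpos : 0 < R x o + 1 := by linarith [hR.nonneg x o]
    obtain ⟨N, hN⟩ := hf (ε ^ 2 / (R x o + 1)) (by positivity)
    refine ⟨N, fun m hm n hn => ?_⟩
    have h1 := hN m hm n hn
    rw [lt_div_iff₀ hpos] at h1
    have h2 := hR.sub_sq_le_energyForm o x (f m - f n)
    have h3 := hR.energyForm_nonneg (f m - f n)
    rw [Real.dist_eq]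
    apply abs_lt_of_sq_lt_sq _ hε.le
    have h4 : F m x - F n x =
        (f m - f n : hR.energyDomain).1 x - (f m - f n : hR.energyDomain).1 o := by
      simp only [F, Submodule.coe_sub, Pi.sub_apply]; ring
    rw [h4]
    nlinarith
  choose g hg using hcau
  have hbound : ∀ ε > 0, ∃ N, ∀ m ≥ N, ∀ V, hR.traceForm V (f m - g) (f m - g) ≤ ε := by
    intro ε hε
    obtain ⟨N, hN⟩ := hf ε hε
    refine ⟨N, fun m hm V => ?_⟩
    have hlim : Tendsto (fun n => hR.traceForm V ((f m : X → ℝ) - F n) (f m - F n)) atTop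
        (𝓝 (hR.traceForm V (f m - g) (f m - g))) := by
      simp only [traceForm_apply, conductanceForm_apply, Pi.sub_apply]
      refine Tendsto.const_mul _ (tendsto_finsetSum _ fun a _ => tendsto_finsetSum _ fun b _ => ?_)
      have hab := (((hg a).const_sub ((f m : X → ℝ) a)).sub ((hg b).const_sub ((f m : X → ℝ) b)))
      exact (hab.mul hab).const_mul _
    refine le_of_tendsto hlim ((eventually_ge_atTop N).mono fun n hn => ?_)
    have h1 := (hR.traceForm_le_energyForm V (f m - f n)).trans (hN m hm n hn).le
    refine Eq.trans_le ?_ h1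
    simp only [traceForm_apply, conductanceForm_apply, F, Submodule.coe_sub, Pi.sub_apply]
    congr 1
    refine Finset.sum_congr rfl fun a _ => Finset.sum_congr rfl fun b _ => ?_
    ring
  obtain ⟨N, hN⟩ := hbound 1 one_pos
  have hgm : g ∈ hR.energyDomain := by
    have := hR.energyDomain.sub_mem (f N).2 (hR.mem_energyDomain (hN N le_rfl))
    simpa using this
  let g' : hR.energyDomain := ⟨g, hgm⟩
  have hle : ∀ n a, (∀ V, hR.traceForm V (f n - g) (f n - g) ≤ a) →
      hR.energyForm (f n - g') (f n - g') ≤ a := fun n a h => hR.energyForm_le h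
  refine ⟨g', Metric.tendsto_atTop.2 fun ε hε => ?_⟩
  obtain ⟨N, hN⟩ := hbound (ε / 2) (half_pos hε)
  refine ⟨N, fun n hn => ?_⟩
  rw [Real.dist_eq, sub_zero, abs_of_nonneg (hR.energyForm_nonneg _)]
  exact (hle n _ (hN n hn)).trans_lt (half_lt_self hε)

theorem exists_energyDomain_extension (V : Finset X) (u : V → ℝ) :
    ∃ f : hR.energyDomain, ∀ p : V, (f : X → ℝ) p = u p := by
  classical
  rcases V.eq_empty_or_nonempty with rfl | ⟨o, ho⟩
  · exact ⟨0, fun p => absurd p.2 (Finset.notMem_empty _)⟩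
  let u' : X → ℝ := fun x => if h : x ∈ V then u ⟨x, h⟩ else 0
  obtain ⟨h, hh⟩ := hR.exists_harmonic ho u'
  have hmem : h ∈ hR.energyDomain :=
    hR.mem_energyDomain_of_eventually (a := hR.traceForm V u' h) V fun W hW => (hh W hW h).le
  -- On `V`, `h - u'` has zero energy, so `h` is right up to an additive constant.
  refine ⟨⟨h, hmem⟩ + ⟨fun _ => u' o - h o, hR.const_mem_energyDomain _⟩, fun p => ?_⟩
  have h1 := hR.sub_sq_le_traceForm ho p.2 (h - u')
  rw [map_sub (hR.traceForm V) h u', LinearMap.sub_apply, hh V subset_rfl, sub_self, mul_zero] at h1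
  have h2 := pow_eq_zero_iff two_ne_zero |>.1 (le_antisymm h1 (sq_nonneg _))
  have h3 : u' p = u p := by simp [u']
  simp only [Pi.sub_apply] at h2
  simp only [Submodule.coe_add, Pi.add_apply]
  linarith

/-- The resistance form associated with a resistance metric. -/
noncomputable def toResistanceForm : ResistanceForm X where
  domain := hR.energyDomain
  form := hR.energyForm
  const_mem := hR.const_mem_energyDomain
  symm := hR.energyForm_symm
  nonneg := hR.energyForm_nonneg
  form_self_eq_zero_iff := hR.energyForm_self_eq_zero_iff
  complete := hR.energyForm_complete
  exists_extension := hR.exists_energyDomain_extension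
  resistance_finite p q _ := by
    obtain ⟨k, hk, -⟩ := hR.exists_energyForm_potential p q
    exact bddAbove_ratio (ev := hR.energyDomain.subtype) hR.energyForm_symm hR.energyForm_nonneg hk
  markov f := by
    have h : ∀ V : Finset X, hR.traceForm V (fun x => min (max ((f : X → ℝ) x) 0) 1)
        (fun x => min (max ((f : X → ℝ) x) 0) 1) ≤ hR.energyForm f f := fun V =>
      (conductanceForm_markov (hR.exists_green V).choose_spec.2.1 fun x y =>
        (abs_min_sub_min_le_max _ _ _ _).trans (max_le ((abs_max_sub_max_le_max _ _ _ _).trans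
          (max_le le_rfl (by simp))) (by simp))).trans (hR.traceForm_le_energyForm V f)
    exact ⟨hR.mem_energyDomain h, hR.energyForm_le h⟩

theorem resistance_toResistanceForm (p q : X) : hR.toResistanceForm.resistance p q = R p q := by
  obtain ⟨k, hk, hkk⟩ := hR.exists_energyForm_potential p q
  rw [← hkk]
  exact sSup_ratio_eq (ev := hR.energyDomain.subtype) hR.energyForm_symm hR.energyForm_nonneg
    (fun f => (hR.energyForm_self_eq_zero_iff f).2) hk

end IsResistanceMetric

/-! ### Resistance forms and their Green functions -/

theorem green_comm {X : Type*} {R : X → X → ℝ} (hR : ∀ x y, R x y = R y x) (o x y : X) :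
    green R o x y = green R o y x := by
  simp only [green, hR x y]; ring

namespace ResistanceForm

section Basic

variable {X : Type*} (𝓔 : ResistanceForm X)

/-- (RF4) bounds the increment functional by the energy, and (RF2) lets Riesz representation apply.
-/
theorem exists_potential (p q : X) :
    ∃ k : 𝓔.domain, ∀ f : 𝓔.domain, 𝓔.form k f = (f : X → ℝ) p - (f : X → ℝ) q := by
  rcases eq_or_ne p q with rfl | hpq
  · exact ⟨0, fun f => by simp⟩
  obtain ⟨C, hC⟩ := 𝓔.resistance_finite p q hpq
  let ℓ : 𝓔.domain →ₗ[ℝ] ℝ :=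
    ((LinearMap.proj p : (X → ℝ) →ₗ[ℝ] ℝ) - LinearMap.proj q) ∘ₗ 𝓔.domain.subtype
  refine exists_riesz 𝓔.symm 𝓔.nonneg 𝓔.complete ℓ (C := C) fun f => ?_
  change ((f : X → ℝ) p - (f : X → ℝ) q) ^ 2 ≤ _
  by_cases hf : IsConstFun (f : X → ℝ)
  · rw [(𝓔.form_self_eq_zero_iff f).2 hf]
    obtain ⟨a, ha⟩ := hf
    simp [ha]
  · have hpos : 0 < 𝓔.form f f :=
      (𝓔.nonneg f).lt_of_ne' fun h => hf ((𝓔.form_self_eq_zero_iff f).1 h)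
    have := hC ⟨f, hf, rfl⟩
    rwa [div_le_iff₀ hpos, sq_abs] at this

theorem form_self_eq_resistance (p q : X) (k : 𝓔.domain)
    (hk : ∀ f : 𝓔.domain, 𝓔.form k f = (f : X → ℝ) p - (f : X → ℝ) q) :
    𝓔.form k k = 𝓔.resistance p q :=
  (sSup_ratio_eq (ev := 𝓔.domain.subtype) 𝓔.symm 𝓔.nonneg
    (fun f => (𝓔.form_self_eq_zero_iff f).2) hk).symm

theorem resistance_self (x : X) : 𝓔.resistance x x = 0 :=
  resistance_self_self (ev := 𝓔.domain.subtype) 𝓔.form_self_eq_resistance x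

theorem resistance_nonneg (x y : X) : 0 ≤ 𝓔.resistance x y := by
  obtain ⟨k, hk⟩ := 𝓔.exists_potential x y
  rw [← 𝓔.form_self_eq_resistance x y k hk]
  exact 𝓔.nonneg k

theorem resistance_comm (x y : X) : 𝓔.resistance x y = 𝓔.resistance y x := by
  obtain ⟨k, hk⟩ := 𝓔.exists_potential x y
  rw [← 𝓔.form_self_eq_resistance x y k hk, ← 𝓔.form_self_eq_resistance y x (-k)
    (fun f => by rw [map_neg, LinearMap.neg_apply, hk]; ring)]
  simp

theorem sub_sq_le (x y : X) (f : 𝓔.domain) :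
    ((f : X → ℝ) x - (f : X → ℝ) y) ^ 2 ≤ 𝓔.resistance x y * 𝓔.form f f := by
  obtain ⟨k, hk⟩ := 𝓔.exists_potential x y
  rw [← hk, ← 𝓔.form_self_eq_resistance x y k hk]
  exact form_sq_le 𝓔.symm 𝓔.nonneg k f

theorem form_const_left (a : ℝ) (f : 𝓔.domain) : 𝓔.form ⟨_, 𝓔.const_mem a⟩ f = 0 := by
  have h := form_sq_le 𝓔.symm 𝓔.nonneg ⟨_, 𝓔.const_mem a⟩ f
  rw [(𝓔.form_self_eq_zero_iff ⟨_, 𝓔.const_mem a⟩).2 ⟨a, fun _ => rfl⟩, zero_mul] at h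
  exact pow_eq_zero_iff two_ne_zero |>.1 (le_antisymm h (sq_nonneg _))

theorem form_sub_left (f g h : 𝓔.domain) : 𝓔.form (f - g) h = 𝓔.form f h - 𝓔.form g h := by
  rw [map_sub, LinearMap.sub_apply]

theorem form_const_sub_smul_left (a t : ℝ) (g f : 𝓔.domain) :
    𝓔.form (⟨_, 𝓔.const_mem a⟩ - t • g) f = -(t * 𝓔.form g f) := by
  rw [form_sub_left, form_const_left, map_smul, LinearMap.smul_apply, smul_eq_mul, zero_sub]

/-- The Green function of the resistance metric is the reproducing kernel of the form. -/
theorem exists_green (o x : X) : ∃ k : 𝓔.domain, (k : X → ℝ) = green 𝓔.resistance o x ∧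
    ∀ f : 𝓔.domain, 𝓔.form k f = (f : X → ℝ) x - (f : X → ℝ) o := by
  obtain ⟨kx, hx⟩ := 𝓔.exists_potential x o
  refine ⟨kx - ⟨_, 𝓔.const_mem ((kx : X → ℝ) o)⟩, ?_, fun f => ?_⟩
  · funext y
    obtain ⟨ky, hy⟩ := 𝓔.exists_potential y o
    exact potential_eq_green (ev := 𝓔.domain.subtype) 𝓔.symm 𝓔.form_self_eq_resistance hx hy
  · rw [map_sub, LinearMap.sub_apply, form_const_left, hx, sub_zero]

end Basic

section Continuous

variable {X : Type*} [TopologicalSpace X] (𝓔 : ResistanceForm X)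
  (hc : Continuous fun p : X × X => 𝓔.resistance p.1 p.2)

include hc in
theorem continuous_coe (f : 𝓔.domain) : Continuous (f : X → ℝ) := by
  refine continuous_iff_continuousAt.2 fun x => ?_
  have h1 : Tendsto (fun y => 𝓔.resistance y x * 𝓔.form f f) (𝓝 x) (𝓝 0) := by
    have : Continuous fun y => 𝓔.resistance y x * 𝓔.form f f :=
      (hc.comp (continuous_id.prodMk continuous_const)).mul continuous_const
    simpa [𝓔.resistance_self] using this.tendsto x
  have h2 := squeeze_zero (fun y => sq_nonneg _) (fun y => 𝓔.sub_sq_le y x f) h1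
  have h3 := (Real.continuous_sqrt.tendsto 0).comp h2
  simp only [Function.comp_def, Real.sqrt_sq_eq_abs, Real.sqrt_zero] at h3
  exact tendsto_sub_nhds_zero_iff.1 ((tendsto_zero_iff_abs_tendsto_zero _).2 h3)

include hc in
theorem exists_resistance_le [CompactSpace X] : ∃ K, ∀ x y, 𝓔.resistance x y ≤ K := by
  obtain ⟨K, hK⟩ := (isCompact_range hc).bddAbove
  exact ⟨K, fun x y => hK ⟨(x, y), rfl⟩⟩

end Continuous

/-! ### The resolvent equation in terms of the resistance metric -/

section Equation

variable {X : Type*} [MeasurableSpace X] {𝓔 : ResistanceForm X} {ν : Measure X} {α : ℝ} {x : X}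
  {u : 𝓔.domain} (hu : ∀ f : 𝓔.domain,
    𝓔.form u f + α * ∫ y, (u : X → ℝ) y * (f : X → ℝ) y ∂ν = (f : X → ℝ) x)

include hu in
theorem resolvent_mass : α * ∫ y, (u : X → ℝ) y ∂ν = 1 := by
  have h := hu ⟨_, 𝓔.const_mem 1⟩
  rw [𝓔.symm, form_const_left] at h
  simpa using h

include hu in
/-- The integral equation for the resolvent, with the Green function with pole `x`. -/
theorem resolvent_eq (z : X) : (u : X → ℝ) z =
    (u : X → ℝ) x - α * ∫ y, (u : X → ℝ) y * green 𝓔.resistance x y z ∂ν := by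
  -- The Green function with pole `x` is the test function: it vanishes at `x`, and its energy with
  -- `u` is `u z - u x`.
  obtain ⟨k, hk, hkf⟩ := 𝓔.exists_green x z
  have h := hu k
  rw [𝓔.symm, hkf, hk] at h
  simp only [green_comm 𝓔.resistance_comm x z] at h
  have h0 : green 𝓔.resistance x x z = 0 := by simp [green, 𝓔.resistance_self, 𝓔.resistance_comm x z]
  rw [h0] at h
  linarith

end Equation

/-! ### Resolvents on compact spaces: existence, uniqueness, continuity, stability -/

section Resolvent

variable {X : Type*} [MetricSpace X] [CompactSpace X] [MeasurableSpace X] [BorelSpace X]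

theorem integrable_of_continuous (ν : Measure X) [IsFiniteMeasure ν] {f : X → ℝ}
    (hf : Continuous f) : Integrable f ν :=
  hf.integrable_of_hasCompactSupport (HasCompactSupport.of_compactSpace f)

theorem integrable_mul_of_continuous (ν : Measure X) [IsFiniteMeasure ν] {f g : X → ℝ}
    (hf : Continuous f) (hg : Continuous g) : Integrable (fun y => f y * g y) ν :=
  integrable_of_continuous ν (hf.mul hg)

variable (𝓔 : ResistanceForm X) (hc : Continuous fun p : X × X => 𝓔.resistance p.1 p.2)

variable (ν : Measure X) [IsProbabilityMeasure ν]

include hc in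
/-- The potential of a continuous density with respect to `ν`. -/
theorem exists_integral_potential {φ : X → ℝ} (hφ : Continuous φ) (o : X) :
    ∃ G : 𝓔.domain, (∀ z, (G : X → ℝ) z = ∫ y, φ y * green 𝓔.resistance o y z ∂ν) ∧
      ∀ f : 𝓔.domain, 𝓔.form G f = ∫ y, φ y * ((f : X → ℝ) y - (f : X → ℝ) o) ∂ν := by
  obtain ⟨K, hK⟩ := 𝓔.exists_resistance_le hc
  have hK0 : 0 ≤ K := (𝓔.resistance_nonneg o o).trans (hK o o)
  obtain ⟨M, hM⟩ := isCompact_univ.exists_bound_of_continuousOn hφ.continuousOn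
  have hM0 : 0 ≤ M := (norm_nonneg _).trans (hM o trivial)
  have hint : ∀ f : 𝓔.domain,
      Integrable (fun y => φ y * ((f : X → ℝ) y - (f : X → ℝ) o)) ν := fun f =>
    integrable_of_continuous ν (hφ.mul ((𝓔.continuous_coe hc f).sub continuous_const))
  -- Subtracting the value at `o` makes the functional vanish on constants, so that the energy alone
  -- bounds it.
  let ℓ : 𝓔.domain →ₗ[ℝ] ℝ :=
    { toFun := fun f => ∫ y, φ y * ((f : X → ℝ) y - (f : X → ℝ) o) ∂ν
      map_add' := fun f g => by
        rw [← integral_add (hint f) (hint g)]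
        congr 1; funext y; simp only [Submodule.coe_add, Pi.add_apply]; ring
      map_smul' := fun a f => by
        rw [RingHom.id_apply, smul_eq_mul, ← integral_const_mul]
        congr 1; funext y; simp only [Submodule.coe_smul, Pi.smul_apply, smul_eq_mul]; ring }
  have hbd : ∀ f, ℓ f ^ 2 ≤ M ^ 2 * K * 𝓔.form f f := by
    intro f
    have h1 : ‖ℓ f‖ ≤ M * √(K * 𝓔.form f f) * ν.real Set.univ := by
      refine norm_integral_le_of_norm_le_const (ae_of_all _ fun y => ?_)
      rw [norm_mul]
      refine mul_le_mul (hM y trivial) ?_ (norm_nonneg _) hM0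
      rw [Real.norm_eq_abs]
      refine Real.abs_le_sqrt ((𝓔.sub_sq_le y o f).trans ?_)
      exact mul_le_mul_of_nonneg_right (hK y o) (𝓔.nonneg f)
    rw [probReal_univ, mul_one, Real.norm_eq_abs] at h1
    calc ℓ f ^ 2 = |ℓ f| ^ 2 := (sq_abs _).symm
      _ ≤ (M * √(K * 𝓔.form f f)) ^ 2 := by gcongr
      _ = M ^ 2 * K * 𝓔.form f f := by
        rw [mul_pow, Real.sq_sqrt (mul_nonneg hK0 (𝓔.nonneg f))]; ring
  obtain ⟨h, hh⟩ := exists_riesz 𝓔.symm 𝓔.nonneg 𝓔.complete ℓ hbd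
  refine ⟨h - ⟨_, 𝓔.const_mem ((h : X → ℝ) o)⟩, fun z => ?_, fun f => ?_⟩
  · obtain ⟨k, hk, hkf⟩ := 𝓔.exists_green o z
    have h1 := hkf h
    rw [𝓔.symm, hh] at h1
    change (h : X → ℝ) z - (h : X → ℝ) o = _
    rw [← h1]
    change ∫ y, φ y * ((k : X → ℝ) y - (k : X → ℝ) o) ∂ν = _
    congr 1; funext y
    rw [hk, green_comm 𝓔.resistance_comm o z y]
    simp [green, 𝓔.resistance_self]
  · rw [map_sub, LinearMap.sub_apply, form_const_left, sub_zero, hh]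
    rfl

include hc in
-- Integrate `f(x)² ≤ 2 (f(x) - f(y))² + 2 f(y)²` over `y`.
theorem sq_le_of_resistance_le {K : ℝ} (hK : ∀ x y, 𝓔.resistance x y ≤ K) (f : 𝓔.domain) (x : X) :
    (f : X → ℝ) x ^ 2 ≤ 2 * K * 𝓔.form f f + 2 * ∫ y, (f : X → ℝ) y * (f : X → ℝ) y ∂ν := by
  have hf := 𝓔.continuous_coe hc f
  have h1 : ∀ y, (f : X → ℝ) x ^ 2 ≤ 2 * K * 𝓔.form f f + 2 * ((f : X → ℝ) y * (f : X → ℝ) y) := by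
    intro y
    have h2 := 𝓔.sub_sq_le x y f
    have h3 := mul_le_mul_of_nonneg_right (hK x y) (𝓔.nonneg f)
    nlinarith [sq_nonneg ((f : X → ℝ) x - 2 * (f : X → ℝ) y)]
  have h2 := integral_mono (integrable_const _)
    ((integrable_const (2 * K * 𝓔.form f f)).add
      ((integrable_mul_of_continuous ν hf hf).const_mul 2)) h1
  simp only [Pi.add_apply] at h2
  rw [integral_add (integrable_const _) ((integrable_mul_of_continuous ν hf hf).const_mul 2),
    integral_const_mul 2] at h2
  simpa using h2

include hc in
theorem sq_le_resolvent {K : ℝ} (hK : ∀ x y, 𝓔.resistance x y ≤ K) {α : ℝ} (hα : 0 < α)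
    (f : 𝓔.domain) (x : X) :
    (f : X → ℝ) x ^ 2 ≤ (2 * K + 2 / α) *
      (𝓔.form f f + α * ∫ y, (f : X → ℝ) y * (f : X → ℝ) y ∂ν) := by
  have h1 := 𝓔.sq_le_of_resistance_le hc ν hK f x
  have h2 := 𝓔.nonneg f
  have h3 : 0 ≤ ∫ y, (f : X → ℝ) y * (f : X → ℝ) y ∂ν := integral_nonneg fun y => mul_self_nonneg _
  have hK0 : 0 ≤ K := (𝓔.resistance_nonneg x x).trans (hK x x)
  have h4 : 2 / α * α = 2 := div_mul_cancel₀ _ hα.ne'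
  have h5 : 0 ≤ 2 / α * 𝓔.form f f := by positivity
  have h6 : 0 ≤ 2 * K * (α * ∫ y, (f : X → ℝ) y * (f : X → ℝ) y ∂ν) := by positivity
  calc _ ≤ _ := h1
    _ ≤ 2 * K * 𝓔.form f f + 2 / α * α * (∫ y, (f : X → ℝ) y * (f : X → ℝ) y ∂ν)
        + 2 / α * 𝓔.form f f + 2 * K * (α * ∫ y, (f : X → ℝ) y * (f : X → ℝ) y ∂ν) := by
      rw [h4]; linarith
    _ = _ := by ring

/-- The form `E(f, g) + α ∫ f g dν`. -/
noncomputable def resolventForm (α : ℝ) : 𝓔.domain →ₗ[ℝ] 𝓔.domain →ₗ[ℝ] ℝ :=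
  LinearMap.mk₂ ℝ (fun f g => 𝓔.form f g + α * ∫ y, (f : X → ℝ) y * (g : X → ℝ) y ∂ν)
    (fun f f' g => by
      have h := fun f g => integrable_mul_of_continuous ν
        (𝓔.continuous_coe hc f) (𝓔.continuous_coe hc g)
      simp only [map_add, LinearMap.add_apply, Submodule.coe_add, Pi.add_apply, add_mul]
      rw [integral_add (h f g) (h f' g)]; ring)
    (fun a f g => by
      simp only [map_smul, LinearMap.smul_apply, Submodule.coe_smul, Pi.smul_apply, smul_eq_mul,
        mul_assoc, integral_const_mul]
      ring)
    (fun f g g' => by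
      have h := fun f g => integrable_mul_of_continuous ν
        (𝓔.continuous_coe hc f) (𝓔.continuous_coe hc g)
      simp only [map_add, Submodule.coe_add, Pi.add_apply, mul_add]
      rw [integral_add (h f g) (h f g')]; ring)
    (fun a f g => by
      simp only [map_smul, Submodule.coe_smul, Pi.smul_apply, smul_eq_mul,
        mul_left_comm _ a, integral_const_mul]
      ring)

theorem resolventForm_apply (α : ℝ) (f g : 𝓔.domain) : 𝓔.resolventForm hc ν α f g =
    𝓔.form f g + α * ∫ y, (f : X → ℝ) y * (g : X → ℝ) y ∂ν := rfl

theorem resolventForm_symm (α : ℝ) (f g : 𝓔.domain) :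
    𝓔.resolventForm hc ν α f g = 𝓔.resolventForm hc ν α g f := by
  simp only [resolventForm_apply, 𝓔.symm f g, mul_comm ((f : X → ℝ) _)]

theorem form_le_resolventForm {α : ℝ} (hα : 0 ≤ α) (f : 𝓔.domain) :
    𝓔.form f f ≤ 𝓔.resolventForm hc ν α f f :=
  le_add_of_nonneg_right (mul_nonneg hα (integral_nonneg fun _ => mul_self_nonneg _))

/-- Completeness of `E` fixes the limit up to a constant, and the limit of the values at one point
fixes the constant. Bounded resistance upgrades this to uniform convergence, which controls the
integral term. -/
theorem resolventForm_complete {α : ℝ} (hα : 0 < α) (f : ℕ → 𝓔.domain)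
    (hf : ∀ ε > 0, ∃ N, ∀ m ≥ N, ∀ n ≥ N,
      𝓔.resolventForm hc ν α (f m - f n) (f m - f n) < ε) :
    ∃ g : 𝓔.domain, Tendsto (fun n => 𝓔.resolventForm hc ν α (f n - g) (f n - g)) atTop (𝓝 0) := by
  obtain ⟨o⟩ : Nonempty X := nonempty_of_isProbabilityMeasure ν
  obtain ⟨K, hK⟩ := 𝓔.exists_resistance_le hc
  have hK0 : 0 ≤ K := (𝓔.resistance_nonneg o o).trans (hK o o)
  obtain ⟨g₀, hg₀⟩ := 𝓔.complete f fun ε hε => (hf ε hε).imp fun N hN m hm n hn =>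
    (𝓔.form_le_resolventForm hc ν hα.le _).trans_lt (hN m hm n hn)
  obtain ⟨a, ha⟩ : ∃ a, Tendsto (fun n => (f n : X → ℝ) o) atTop (𝓝 a) := by
    refine cauchySeq_tendsto_of_complete (Metric.cauchySeq_iff.2 fun ε hε => ?_)
    have hpos : 0 < 2 * K + 2 / α := by positivity
    obtain ⟨N, hN⟩ := hf (ε ^ 2 / (2 * K + 2 / α)) (by positivity)
    refine ⟨N, fun m hm n hn => ?_⟩
    have h1 := hN m hm n hn
    rw [lt_div_iff₀' hpos] at h1
    have h2 := (𝓔.sq_le_resolvent hc ν hK hα (f m - f n) o).trans_lt h1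
    rw [Real.dist_eq]
    exact abs_lt_of_sq_lt_sq h2 hε.le
  let g : 𝓔.domain := g₀ + ⟨_, 𝓔.const_mem (a - (g₀ : X → ℝ) o)⟩
  have hform : ∀ n, 𝓔.form (f n - g) (f n - g) = 𝓔.form (f n - g₀) (f n - g₀) := by
    intro n
    have : f n - g = (f n - g₀) - ⟨_, 𝓔.const_mem (a - (g₀ : X → ℝ) o)⟩ := by
      simp only [g]; abel
    rw [this, form_sub_left, form_const_left, 𝓔.symm, form_sub_left, form_const_left]
    ring
  have hgo : (g : X → ℝ) o = a := by simp [g]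
  refine ⟨g, squeeze_zero (fun n => (𝓔.nonneg _).trans (𝓔.form_le_resolventForm hc ν hα.le _))
    (g := fun n => 𝓔.form (f n - g₀) (f n - g₀) +
      α * (2 * ((f n : X → ℝ) o - a) ^ 2 + 2 * K * 𝓔.form (f n - g₀) (f n - g₀)))
    (fun n => ?_) ?_⟩
  · rw [resolventForm_apply, hform]
    have hle : ∀ y, (f n - g : 𝓔.domain).1 y * (f n - g : 𝓔.domain).1 y ≤
        2 * ((f n : X → ℝ) o - a) ^ 2 + 2 * K * 𝓔.form (f n - g₀) (f n - g₀) := by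
      intro y
      have h2 := 𝓔.sub_sq_le y o (f n - g)
      have h3 := mul_le_mul_of_nonneg_right (hK y o) (𝓔.nonneg (f n - g))
      rw [hform] at h2 h3
      have h4 : (f n - g : 𝓔.domain).1 o = (f n : X → ℝ) o - a := by rw [← hgo]; rfl
      rw [← h4]
      nlinarith [sq_nonneg ((f n - g : 𝓔.domain).1 y - 2 * (f n - g : 𝓔.domain).1 o)]
    have hcont := 𝓔.continuous_coe hc (f n - g)
    have := integral_mono (integrable_mul_of_continuous ν hcont hcont)
      (integrable_const (μ := ν) _) hle
    rw [integral_const, probReal_univ, one_smul] at this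
    gcongr
  · have h1 : Tendsto (fun n => ((f n : X → ℝ) o - a)) atTop (𝓝 0) :=
      tendsto_sub_nhds_zero_iff.2 ha
    have := hg₀.add ((((h1.pow 2).const_mul 2).add (hg₀.const_mul (2 * K))).const_mul α)
    simpa using this

include hc in
theorem exists_resolvent {α : ℝ} (hα : 0 < α) (x : X) :
    ∃ u : 𝓔.domain, ∀ f : 𝓔.domain,
      𝓔.form u f + α * ∫ y, (u : X → ℝ) y * (f : X → ℝ) y ∂ν = (f : X → ℝ) x := by
  obtain ⟨K, hK⟩ := 𝓔.exists_resistance_le hc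
  exact exists_riesz (𝓔.resolventForm_symm hc ν α)
    (fun f => (𝓔.nonneg f).trans (𝓔.form_le_resolventForm hc ν hα.le f))
    (𝓔.resolventForm_complete hc ν hα)
    ((LinearMap.proj x : (X → ℝ) →ₗ[ℝ] ℝ) ∘ₗ 𝓔.domain.subtype)
    (𝓔.sq_le_resolvent hc ν hK hα · x)

variable {𝓔 ν} {α : ℝ} {x : X} {u : 𝓔.domain}
  (hu : ∀ f : 𝓔.domain,
    𝓔.form u f + α * ∫ y, (u : X → ℝ) y * (f : X → ℝ) y ∂ν = (f : X → ℝ) x)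

include hc in
-- The two forms may differ, so they are not compared. The difference `w` satisfies the homogeneous
-- integral equation, which places it in the domain of `𝓔`. Since `w` has mean zero, `E(w, w) = -α ∫
-- w²`; so `w` is constant, hence zero.
theorem resolvent_unique {𝓔' : ResistanceForm X} (h𝓔 : ∀ p q, 𝓔'.resistance p q = 𝓔.resistance p q)
    (hα : 0 < α) (hu : ∀ f : 𝓔.domain,
      𝓔.form u f + α * ∫ y, (u : X → ℝ) y * (f : X → ℝ) y ∂ν = (f : X → ℝ) x) {u' : 𝓔'.domain}
    (hu' : ∀ f : 𝓔'.domain,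
      𝓔'.form u' f + α * ∫ y, (u' : X → ℝ) y * (f : X → ℝ) y ∂ν = (f : X → ℝ) x) :
    (u : X → ℝ) = u' := by
  have hRR : 𝓔'.resistance = 𝓔.resistance := funext fun p => funext fun q => h𝓔 p q
  have hcu := 𝓔.continuous_coe hc u
  have hcu' := 𝓔'.continuous_coe (hRR ▸ hc) u'
  have hgc : ∀ z, Continuous fun y => green 𝓔.resistance x y z := fun z => by
    unfold green
    exact (((hc.comp (continuous_id.prodMk continuous_const)).add continuous_const).sub
      (hc.comp (continuous_id.prodMk continuous_const))).div_const 2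
  set w : X → ℝ := fun y => (u : X → ℝ) y - (u' : X → ℝ) y with hw
  have hcw : Continuous w := hcu.sub hcu'
  obtain ⟨G, hG, hGf⟩ := 𝓔.exists_integral_potential hc ν hcw x
  have hmass : ∫ y, w y ∂ν = 0 := by
    rw [integral_sub (integrable_of_continuous ν hcu) (integrable_of_continuous ν hcu')]
    have h1 := resolvent_mass hu
    have h2 := resolvent_mass hu'
    have : α * (∫ y, (u : X → ℝ) y ∂ν - ∫ y, (u' : X → ℝ) y ∂ν) = 0 := by rw [mul_sub]; linarith
    exact (mul_eq_zero.1 this).resolve_left hα.ne'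
  have hweq : ∀ z, w z = w x - α * (G : X → ℝ) z := by
    intro z
    rw [hG]
    simp only [hw, sub_mul]
    rw [integral_sub (integrable_mul_of_continuous ν hcu (hgc z))
      (integrable_mul_of_continuous ν hcu' (hgc z))]
    have h1 := resolvent_eq hu z
    have h2 := resolvent_eq hu' z
    rw [hRR] at h2
    linarith
  let W : 𝓔.domain := ⟨_, 𝓔.const_mem (w x)⟩ - α • G
  have hW : (W : X → ℝ) = w := funext fun z => (hweq z).symm
  have hWW : 𝓔.form W W = -(α * ∫ y, w y * w y ∂ν) := by
    have h1 : 𝓔.form W W = -(α * 𝓔.form G W) := 𝓔.form_const_sub_smul_left _ _ _ _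
    rw [h1, hGf, hW]
    simp only [mul_sub]
    rw [integral_sub (integrable_mul_of_continuous ν hcw hcw)
      (integrable_mul_of_continuous ν hcw continuous_const), integral_mul_const, hmass]
    ring
  have h0 : 𝓔.form W W = 0 := by
    refine le_antisymm ?_ (𝓔.nonneg W)
    rw [hWW, neg_nonpos]
    exact mul_nonneg hα.le (integral_nonneg fun _ => mul_self_nonneg _)
  obtain ⟨a, ha⟩ := (𝓔.form_self_eq_zero_iff W).1 h0
  rw [hW] at ha
  have ha0 : a = 0 := by simpa [ha] using hmass
  funext z
  have := ha z
  rw [ha0] at this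
  exact sub_eq_zero.1 this

include hc hu in
-- Testing the equation with `u` itself makes the resolvent energy equal to `u x`, while `(u x)²` is
-- at most a constant times that energy.
theorem resolvent_self_le {K : ℝ} (hK : ∀ x y, 𝓔.resistance x y ≤ K) (hα : 0 < α) :
    𝓔.form u u ≤ 2 * K + 2 / α := by
  have h1 := 𝓔.sq_le_resolvent hc ν hK hα u x
  have h2 := 𝓔.form_le_resolventForm hc ν hα.le u
  rw [resolventForm_apply] at h2
  rw [hu] at h1 h2
  have h3 := 𝓔.nonneg u
  refine h2.trans ?_
  rcases (h3.trans h2).eq_or_lt with h4 | h4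
  · rw [← h4]
    have := (𝓔.resistance_nonneg x x).trans (hK x x)
    positivity
  · exact le_of_mul_le_mul_right (by rwa [← sq]) h4

include hc in
-- The energies of all `u x` share one bound, so the kernel is equicontinuous in its second
-- variable; symmetry transfers this to the first.
theorem continuous_resolvent (hα : 0 < α) {u : X → 𝓔.domain}
    (hu : ∀ (x : X) (f : 𝓔.domain),
      𝓔.form (u x) f + α * ∫ y, (u x : X → ℝ) y * (f : X → ℝ) y ∂ν = (f : X → ℝ) x) :
    Continuous fun p : X × X => (u p.1 : X → ℝ) p.2 := by
  obtain ⟨K, hK⟩ := 𝓔.exists_resistance_le hc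
  have hsymm : ∀ x y, (u x : X → ℝ) y = (u y : X → ℝ) x := by
    intro x y
    rw [← hu y (u x), ← hu x (u y), 𝓔.symm]
    simp only [mul_comm]
  have hle : ∀ a x y, |(u a : X → ℝ) x - (u a : X → ℝ) y| ≤
      √(𝓔.resistance x y * (2 * K + 2 / α)) := fun a x y =>
    Real.abs_le_sqrt ((𝓔.sub_sq_le x y (u a)).trans
      (mul_le_mul_of_nonneg_left (resolvent_self_le hc (hu a) hK hα) (𝓔.resistance_nonneg x y)))
  refine continuous_iff_continuousAt.2 fun ⟨x, y⟩ => ?_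
  refine tendsto_sub_nhds_zero_iff.1 (squeeze_zero_norm (a := fun p : X × X =>
    √(𝓔.resistance p.2 y * (2 * K + 2 / α)) + √(𝓔.resistance p.1 x * (2 * K + 2 / α))) ?_ ?_)
  · rintro ⟨x', y'⟩
    simp only [Real.norm_eq_abs]
    calc _ ≤ |(u x' : X → ℝ) y' - (u x' : X → ℝ) y| + |(u x' : X → ℝ) y - (u x : X → ℝ) y| :=
          abs_sub_le _ _ _
      _ ≤ _ := by
        refine add_le_add (hle _ _ _) ?_
        rw [hsymm x' y, hsymm x y]
        exact hle _ _ _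
  · have hcont : Continuous fun p : X × X =>
        √(𝓔.resistance p.2 y * (2 * K + 2 / α)) + √(𝓔.resistance p.1 x * (2 * K + 2 / α)) :=
      (((hc.comp (continuous_snd.prodMk continuous_const)).mul continuous_const).sqrt).add
        (((hc.comp (continuous_fst.prodMk continuous_const)).mul continuous_const).sqrt)
    simpa [𝓔.resistance_self] using hcont.tendsto (x, y)

include hc hu in
/-- An approximate solution `U` of the integral equation is uniformly close to the resolvent. -/
theorem abs_resolvent_sub_le (hα : 0 < α) {K : ℝ} (hK : ∀ x y, 𝓔.resistance x y ≤ K) {U : X → ℝ}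
    (hU : Continuous U) {δ : ℝ}
    (hδ : ∀ z, |U z - (U x - α * ∫ y, U y * green 𝓔.resistance x y z ∂ν)| ≤ δ) (z : X) :
    |(u : X → ℝ) z - (U x - α * ∫ y, U y * green 𝓔.resistance x y z ∂ν)| ≤
      (2 * K + 2 / α) * (|1 - α * ∫ y, U y ∂ν| + α * δ) := by
  obtain ⟨G, hG, hGf⟩ := 𝓔.exists_integral_potential hc ν hU x
  simp only [← hG] at hδ ⊢
  let v : 𝓔.domain := ⟨_, 𝓔.const_mem (U x)⟩ - α • G
  have hv : ∀ z, (v : X → ℝ) z = U x - α * (G : X → ℝ) z := fun z => rfl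
  let w : 𝓔.domain := u - v
  have hw : ∀ z, (w : X → ℝ) z = (u : X → ℝ) z - (v : X → ℝ) z := fun z => rfl
  simp only [← hv, ← hw] at hδ ⊢
  have hcv := 𝓔.continuous_coe hc v
  have hcu := 𝓔.continuous_coe hc u
  have hcw := 𝓔.continuous_coe hc w
  obtain ⟨z₀, -, hz₀⟩ := isCompact_univ.exists_isMaxOn ⟨x, trivial⟩ hcw.abs.continuousOn
  have hmax : ∀ y, |(w : X → ℝ) y| ≤ |(w : X → ℝ) z₀| := fun y => hz₀ (Set.mem_univ y)
  have hδ0 : 0 ≤ δ := (abs_nonneg _).trans (hδ x)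
  -- The energy of the error is linear in `w` times the two defects, whereas it dominates the square
  -- of `sup |w|`. Dividing by `sup |w|` gives the estimate.
  have henergy : 𝓔.form w w + α * ∫ y, (w : X → ℝ) y * (w : X → ℝ) y ∂ν =
      (w : X → ℝ) x * (1 - α * ∫ y, U y ∂ν) +
        α * ∫ y, (U y - (v : X → ℝ) y) * (w : X → ℝ) y ∂ν := by
    have h1 := hu w
    have h2 : 𝓔.form v w = -(α * (∫ y, U y * (w : X → ℝ) y ∂ν - (∫ y, U y ∂ν) * (w : X → ℝ) x)) := by
      have h3 : 𝓔.form v w = -(α * 𝓔.form G w) := 𝓔.form_const_sub_smul_left _ _ _ _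
      rw [h3, hGf]
      simp only [mul_sub]
      rw [integral_sub (integrable_mul_of_continuous ν hU hcw) (integrable_mul_of_continuous ν hU continuous_const), integral_mul_const]
      ring
    have h4 : 𝓔.form w w = 𝓔.form u w - 𝓔.form v w := 𝓔.form_sub_left _ _ _
    have h5 : ∫ y, (w : X → ℝ) y * (w : X → ℝ) y ∂ν =
        ∫ y, (u : X → ℝ) y * (w : X → ℝ) y ∂ν - ∫ y, (v : X → ℝ) y * (w : X → ℝ) y ∂ν := by
      rw [← integral_sub (integrable_mul_of_continuous ν hcu hcw) (integrable_mul_of_continuous ν hcv hcw)]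
      congr 1; funext y; rw [hw y]; ring
    simp only [sub_mul (U _)]
    rw [integral_sub (integrable_mul_of_continuous ν hU hcw) (integrable_mul_of_continuous ν hcv hcw), h4, h5, h2]
    linear_combination h1
  have hb : |∫ y, (U y - (v : X → ℝ) y) * (w : X → ℝ) y ∂ν| ≤ δ * |(w : X → ℝ) z₀| := by
    have := norm_integral_le_of_norm_le_const (μ := ν)
      (f := fun y => (U y - (v : X → ℝ) y) * (w : X → ℝ) y) (C := δ * |(w : X → ℝ) z₀|)
      (ae_of_all _ fun y => by
        rw [norm_mul]
        exact mul_le_mul (hδ y) (hmax y) (norm_nonneg _) hδ0)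
    simpa using this
  have hsq := 𝓔.sq_le_resolvent hc ν hK hα w z₀
  have hK0 : 0 ≤ K := (𝓔.resistance_nonneg x x).trans (hK x x)
  have hE : 𝓔.form w w + α * ∫ y, (w : X → ℝ) y * (w : X → ℝ) y ∂ν ≤
      |(w : X → ℝ) z₀| * (|1 - α * ∫ y, U y ∂ν| + α * δ) := by
    rw [henergy, mul_add]
    refine add_le_add ((le_abs_self _).trans ?_) ?_
    · rw [abs_mul]
      exact mul_le_mul_of_nonneg_right (hmax x) (abs_nonneg _)
    · calc _ ≤ α * (δ * |(w : X → ℝ) z₀|) := by gcongr; exact (le_abs_self _).trans hb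
        _ = _ := by ring
  have hC : 0 ≤ 2 * K + 2 / α := by positivity
  have h6 := hsq.trans (mul_le_mul_of_nonneg_left hE hC)
  refine (hmax z).trans ?_
  rcases (abs_nonneg ((w : X → ℝ) z₀)).eq_or_lt with h0 | h0
  · rw [← h0]; positivity
  · refine le_of_mul_le_mul_right ?_ h0
    rw [← sq, sq_abs]
    linarith

end Resolvent

end ResistanceForm

namespace ResistanceForm

/-- Potentials add. The lossy factor `2` is harmless, as this serves only a uniform bound on the
resistances. -/
theorem resistance_le_two_mul {X : Type*} (𝓔 : ResistanceForm X) (x y z : X) :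
    𝓔.resistance x z ≤ 2 * 𝓔.resistance x y + 2 * 𝓔.resistance y z := by
  obtain ⟨k, hk⟩ := 𝓔.exists_potential x y
  obtain ⟨l, hl⟩ := 𝓔.exists_potential y z
  rw [← 𝓔.form_self_eq_resistance x y k hk, ← 𝓔.form_self_eq_resistance y z l hl,
    ← 𝓔.form_self_eq_resistance x z (k + l)
      (fun f => by rw [map_add, LinearMap.add_apply, hk, hl]; ring)]
  exact form_add_self_le 𝓔.symm 𝓔.nonneg k l

end ResistanceForm

/-- Existence and uniqueness of resolvent kernels on compact spaces. -/
theorem IsResistanceMetric.existsUnique_resolventKernel {X : Type*} [MetricSpace X]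
    [CompactSpace X] [MeasurableSpace X] [BorelSpace X] {R : X → X → ℝ} (hR : IsResistanceMetric R)
    (hc : Continuous fun p : X × X => R p.1 p.2) (ν : Measure X) [IsProbabilityMeasure ν] {α : ℝ}
    (hα : 0 < α) : ∃! u : X → X → ℝ, IsResolventKernel R ν α u := by
  have hR𝓔 : hR.toResistanceForm.resistance = R :=
    funext fun p => funext fun q => hR.resistance_toResistanceForm p q
  have hc𝓔 : Continuous fun p : X × X => hR.toResistanceForm.resistance p.1 p.2 := by
    rw [hR𝓔]; exact hc
  choose u hu using hR.toResistanceForm.exists_resolvent hc𝓔 ν hα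
  refine ⟨fun x => u x, ⟨hR.toResistanceForm, hR.resistance_toResistanceForm,
    fun x => ⟨(u x).2, hu x⟩⟩, ?_⟩
  rintro u' ⟨𝓔, h𝓔, hu'⟩
  funext x
  obtain ⟨hx, hux⟩ := hu' x
  exact (ResistanceForm.resolvent_unique (𝓔' := 𝓔) hc𝓔
    (fun p q => by rw [h𝓔, hR𝓔]) hα (hu x) (u' := ⟨u' x, hx⟩) hux).symm

theorem IsResolventKernel.continuous {X : Type*} [MetricSpace X]
    [CompactSpace X] [MeasurableSpace X] [BorelSpace X] {R : X → X → ℝ}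
    (hc : Continuous fun p : X × X => R p.1 p.2) {ν : Measure X} [IsProbabilityMeasure ν] {α : ℝ}
    (hα : 0 < α) {u : X → X → ℝ} (hu : IsResolventKernel R ν α u) :
    Continuous fun p : X × X => u p.1 p.2 := by
  obtain ⟨𝓔, h𝓔, hu⟩ := hu
  obtain rfl : 𝓔.resistance = R := funext fun p => funext fun q => h𝓔 p q
  choose hmem hu using hu
  exact ResistanceForm.continuous_resolvent hc hα (u := fun x => ⟨u x, hmem x⟩) hu

/-! ### Convergence of functions on varying sets -/

/-- Continuous convergence of functions on varying sets. -/
def FunTendsto {B : Type*} [TopologicalSpace B] {An : ℕ → Set B} {A : Set B}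
    (hn : ∀ n, An n → ℝ) (h : A → ℝ) : Prop :=
  ∀ (y : A) (yn : ∀ n, An n), Tendsto (fun n => (yn n : B)) atTop (𝓝 (y : B)) →
    Tendsto (fun n => hn n (yn n)) atTop (𝓝 (h y))

section Varying

variable {B : Type*} [MetricSpace B] {An : ℕ → Set B} {A : Set B}

theorem exists_tendsto_of_hausdorff (hAn : ∀ n, IsCompact (An n)) (hne : ∀ n, (An n).Nonempty)
    (hH : Tendsto (fun n => Metric.hausdorffEDist (An n) A) atTop (𝓝 0)) (y : A) :
    ∃ yn : ∀ n, An n, Tendsto (fun n => (yn n : B)) atTop (𝓝 (y : B)) := by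
  have hex : ∀ n, ∃ z ∈ An n, Metric.infEDist (y : B) (An n) = edist (y : B) z := fun n =>
    (hAn n).exists_infEDist_eq_edist (hne n) y
  choose z hz hzy using hex
  refine ⟨fun n => ⟨z n, hz n⟩, tendsto_iff_edist_tendsto_0.2 ?_⟩
  refine tendsto_of_tendsto_of_tendsto_of_le_of_le tendsto_const_nhds hH (fun n => zero_le)
    fun n => ?_
  simp only
  rw [edist_comm, ← hzy, Metric.hausdorffEDist_comm]
  exact Metric.infEDist_le_hausdorffEDist_of_mem y.2

theorem eventually_subset_of_hausdorff (hA : IsCompact A)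
    (hH : Tendsto (fun n => Metric.hausdorffEDist (An n) A) atTop (𝓝 0)) {U : Set B}
    (hU : IsOpen U) (hAU : A ⊆ U) : ∀ᶠ n in atTop, An n ⊆ U := by
  obtain ⟨δ, hδ, hsub⟩ := hA.exists_thickening_subset_open hU hAU
  filter_upwards [hH.eventually (gt_mem_nhds (ENNReal.ofReal_pos.2 hδ))] with n hn y hy
  exact hsub ((Metric.infEDist_le_hausdorffEDist_of_mem hy).trans_lt hn)

variable {hn : ∀ n, An n → ℝ} {h : A → ℝ}

/-- If this fails, bad points at infinitely many indices can be spliced into an approximating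
sequence, contradicting convergence along it. -/
theorem FunTendsto.locally (happ : ∀ y : A, ∃ yn : ∀ n, An n,
      Tendsto (fun n => (yn n : B)) atTop (𝓝 (y : B)))
    (hh : FunTendsto hn h) (y : A) {ε : ℝ} (hε : 0 < ε) :
    ∃ δ > 0, ∀ᶠ n in atTop, ∀ z : An n, dist (z : B) y < δ → |hn n z - h y| < ε := by
  classical
  by_contra! hcon
  have hfreq : ∀ k : ℕ, ∃ᶠ n in atTop,
      ∃ z : An n, dist (z : B) y < 1 / (k + 1) ∧ ε ≤ |hn n z - h y| := fun k =>
    hcon (1 / (k + 1)) (by positivity)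
  obtain ⟨φ, hφ, hbad⟩ := extraction_forall_of_frequently hfreq
  obtain ⟨yn, hyn⟩ := happ y
  let P : ∀ n, An n → Prop := fun n z =>
    ∃ k : ℕ, φ k = n ∧ dist (z : B) y < 1 / (k + 1) ∧ ε ≤ |hn n z - h y|
  let zn : ∀ n, An n := fun n => if hP : ∃ z, P n z then hP.choose else yn n
  have hzn : Tendsto (fun n => (zn n : B)) atTop (𝓝 (y : B)) := by
    refine Metric.tendsto_atTop.2 fun δ hδ => ?_
    obtain ⟨k₀, hk₀⟩ := exists_nat_one_div_lt hδ
    obtain ⟨N, hN⟩ := Metric.tendsto_atTop.1 hyn δ hδ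
    refine ⟨max N (φ k₀), fun n hnn => ?_⟩
    by_cases hP : ∃ z, P n z
    · simp only [zn, dif_pos hP]
      obtain ⟨k, hk, hdist, -⟩ := hP.choose_spec
      have hkk : k₀ ≤ k := hφ.le_iff_le.1 (hk ▸ (le_max_right N (φ k₀)).trans hnn)
      refine hdist.trans (lt_of_le_of_lt ?_ hk₀)
      exact one_div_le_one_div_of_le (by positivity) (by exact_mod_cast Nat.succ_le_succ hkk)
    · simp only [zn, dif_neg hP]
      exact hN n ((le_max_left _ _).trans hnn)
  have hlim := (hh y zn hzn).comp hφ.tendsto_atTop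
  obtain ⟨k, hk⟩ := (hlim.eventually (Metric.ball_mem_nhds (h y) hε)).exists
  obtain ⟨z, hz⟩ := hbad k
  have hP : ∃ z, P (φ k) z := ⟨z, k, rfl, hz⟩
  -- The chosen point need not be `z`, but it violates the same bound.
  obtain ⟨-, -, -, hle⟩ := hP.choose_spec
  simp only [Function.comp_apply, zn, dif_pos hP, Real.dist_eq] at hk
  linarith

theorem FunTendsto.continuous (happ : ∀ y : A, ∃ yn : ∀ n, An n,
      Tendsto (fun n => (yn n : B)) atTop (𝓝 (y : B)))
    (hh : FunTendsto hn h) : Continuous h := by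
  refine Metric.continuous_iff.2 fun y ε hε => ?_
  obtain ⟨δ, hδ, hev⟩ := hh.locally happ y (half_pos hε)
  refine ⟨δ, hδ, fun z hz => ?_⟩
  obtain ⟨zn, hzn⟩ := happ z
  have h1 : ∀ᶠ n in atTop, dist (zn n : B) y < δ :=
    (hzn.dist tendsto_const_nhds).eventually (gt_mem_nhds hz)
  have h2 : |h z - h y| ≤ ε / 2 := by
    refine le_of_tendsto ((hh z zn hzn).sub_const (h y)).abs ?_
    filter_upwards [h1, hev] with n hn1 hn2 using (hn2 _ hn1).le
  rw [Real.dist_eq]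
  linarith

/-- Finitely many of the local neighbourhoods cover `A`, hence eventually `An n`. The extension `H`
allows comparison at points outside `A`. -/
theorem FunTendsto.uniform (hA : IsCompact A)
    (hH : Tendsto (fun n => Metric.hausdorffEDist (An n) A) atTop (𝓝 0))
    (happ : ∀ y : A, ∃ yn : ∀ n, An n, Tendsto (fun n => (yn n : B)) atTop (𝓝 (y : B)))
    (hh : FunTendsto hn h) {H : B → ℝ} (hHc : Continuous H) (hHh : ∀ y : A, H y = h y) {ε : ℝ}
    (hε : 0 < ε) : ∀ᶠ n in atTop, ∀ z : An n, |hn n z - H z| < ε := by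
  have hloc : ∀ y : A, ∃ δ > 0, (∀ z : B, dist z y < δ → |H z - h y| < ε / 2) ∧
      ∀ᶠ n in atTop, ∀ z : An n, dist (z : B) y < δ → |hn n z - h y| < ε / 2 := by
    intro y
    obtain ⟨δ₁, hδ₁, h1⟩ := hh.locally happ y (half_pos hε)
    obtain ⟨δ₂, hδ₂, h2⟩ := Metric.continuous_iff.1 hHc y (ε / 2) (half_pos hε)
    refine ⟨min δ₁ δ₂, lt_min hδ₁ hδ₂, fun z hz => ?_, h1.mono fun n hn z hz =>
      hn z (hz.trans_le (min_le_left _ _))⟩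
    rw [← hHh]
    exact h2 z (hz.trans_le (min_le_right _ _))
  choose δ hδ hHδ hev using hloc
  obtain ⟨t, ht⟩ := hA.elim_nhds_subcover' (fun y hy => Metric.ball y (δ ⟨y, hy⟩))
    fun y hy => Metric.ball_mem_nhds y (hδ ⟨y, hy⟩)
  have hsub := eventually_subset_of_hausdorff hA hH
    (isOpen_biUnion fun (y : A) (_ : y ∈ t) => Metric.isOpen_ball) ht
  have hall : ∀ᶠ n in atTop, ∀ y ∈ t, ∀ z : An n, dist (z : B) y < δ y → |hn n z - h y| < ε / 2 :=
    (eventually_all_finset t).2 fun y _ => hev y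
  filter_upwards [hsub, hall] with n hn1 hn2 z
  obtain ⟨y, hyt, hzy⟩ := Set.mem_iUnion₂.1 (hn1 z.2)
  have h1 := hn2 y hyt z hzy
  have h2 := hHδ y z hzy
  calc |hn n z - H z| ≤ |hn n z - h y| + |h y - H z| := abs_sub_le _ _ _
    _ < ε := by rw [abs_sub_comm (h y)]; linarith

theorem exists_continuous_extension (hA : IsClosed A) (hc : Continuous h) :
    ∃ H : B → ℝ, Continuous H ∧ ∀ y : A, H y = h y := by
  obtain ⟨H, hH⟩ := ContinuousMap.exists_restrict_eq hA (⟨h, hc⟩ : C(A, ℝ))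
  exact ⟨H, H.continuous, fun y => DFunLike.congr_fun hH y⟩

/-! ### Integrals against weakly convergent measures -/

section Measure

variable [MeasurableSpace B] [BorelSpace B] [CompactSpace B]

theorem integral_measureOn (hA : IsClosed A) {μ : Measure B} (hμ : μ.support = A) (H : B → ℝ) :
    ∫ y : A, H y ∂(measureOn A μ) = ∫ y, H y ∂μ := by
  rw [measureOn, integral_subtype_comap hA.measurableSet, Measure.restrict_eq_self_of_ae_mem]
  rw [← hμ]
  exact Measure.support_mem_ae

theorem isProbabilityMeasure_measureOn (hA : IsClosed A) {μ : Measure B} [IsProbabilityMeasure μ]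
    (hμ : μ.support = A) : IsProbabilityMeasure (measureOn A μ) := by
  constructor
  rw [measureOn, (MeasurableEmbedding.subtype_coe hA.measurableSet).comap_apply, Set.image_univ,
    Subtype.range_coe]
  refine prob_compl_eq_zero_iff hA.measurableSet |>.1 ?_
  rw [← hμ]
  exact Measure.measure_compl_support

/-- Weak convergence handles the fixed extension `H`; the error `hn n - H` is uniformly small on the
set carrying the measure. -/
theorem FunTendsto.integral (hAn : ∀ n, IsCompact (An n)) (hA : IsCompact A)
    (hH : Tendsto (fun n => Metric.hausdorffEDist (An n) A) atTop (𝓝 0))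
    (happ : ∀ y : A, ∃ yn : ∀ n, An n, Tendsto (fun n => (yn n : B)) atTop (𝓝 (y : B)))
    {μn : ℕ → ProbabilityMeasure B} {μ : ProbabilityMeasure B}
    (hμn : ∀ n, (μn n : Measure B).support = An n) (hμ : (μ : Measure B).support = A)
    (hweak : Tendsto μn atTop (𝓝 μ)) (hcn : ∀ n, Continuous (hn n)) (hh : FunTendsto hn h) :
    Tendsto (fun n => ∫ y, hn n y ∂(measureOn (An n) (μn n))) atTop
      (𝓝 (∫ y, h y ∂(measureOn A μ))) := by
  obtain ⟨H, hHc, hHh⟩ := exists_continuous_extension hA.isClosed (hh.continuous happ)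
  have h1 : Tendsto (fun n => ∫ y : An n, H y ∂(measureOn (An n) (μn n))) atTop
      (𝓝 (∫ y, h y ∂(measureOn A μ))) := by
    simp only [← hHh]
    rw [integral_measureOn hA.isClosed hμ]
    simp only [integral_measureOn (hAn _).isClosed (hμn _)]
    exact ProbabilityMeasure.tendsto_iff_forall_integral_tendsto.1 hweak
      (BoundedContinuousFunction.mkOfCompact ⟨H, hHc⟩)
  have h2 : Tendsto (fun n => ∫ y, hn n y ∂(measureOn (An n) (μn n)) -
      ∫ y : An n, H y ∂(measureOn (An n) (μn n))) atTop (𝓝 0) := by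
    refine Metric.tendsto_nhds.2 fun ε hε => ?_
    filter_upwards [hh.uniform hA hH happ hHc hHh (half_pos hε)] with n hu
    have := isProbabilityMeasure_measureOn (hAn n).isClosed (hμn n)
    have : CompactSpace (An n) := isCompact_iff_compactSpace.1 (hAn n)
    have hint : Integrable (fun y : An n => H y) (measureOn (An n) (μn n)) :=
      ResistanceForm.integrable_of_continuous _ (hHc.comp continuous_subtype_val)
    rw [dist_zero_right,
      ← integral_sub (ResistanceForm.integrable_of_continuous _ (hcn n)) hint]
    have hle := norm_integral_le_of_norm_le_const (μ := measureOn (An n) (μn n))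
      (f := fun y : An n => hn n y - H y) (C := ε / 2) (ae_of_all _ fun y => (hu y).le)
    rw [probReal_univ, mul_one] at hle
    exact hle.trans_lt (half_lt_self hε)
  simpa using h2.add h1

end Measure

end Varying

/-! ### Convergence of resolvent kernels -/

theorem continuous_of_continuous_left {A : Type*} [TopologicalSpace A] {R : A → A → ℝ}
    (hR : IsMetricOn R) (h : ∀ x, Continuous fun y => R y x) :
    Continuous fun p : A × A => R p.1 p.2 := by
  refine continuous_iff_continuousAt.2 fun ⟨x, y⟩ => ?_
  refine tendsto_sub_nhds_zero_iff.1 (squeeze_zero_norm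
    (a := fun p : A × A => R p.1 x + R p.2 y) ?_ ?_)
  · rintro ⟨x', y'⟩
    rw [Real.norm_eq_abs, abs_le]
    have h1 := hR.triangle x' x y'
    have h2 := hR.triangle x y y'
    have h3 := hR.triangle x x' y
    have h4 := hR.triangle x' y' y
    have h5 := hR.symm y y'
    have h6 := hR.symm x x'
    constructor <;> simp only <;> linarith
  · have hcont : Continuous fun p : A × A => R p.1 x + R p.2 y :=
      ((h x).comp continuous_fst).add ((h y).comp continuous_snd)
    simpa [(hR.eq_zero_iff _ _).2] using hcont.tendsto (x, y)

theorem continuous_green {X : Type*} [TopologicalSpace X] {R : X → X → ℝ}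
    (hc : Continuous fun p : X × X => R p.1 p.2) (o z : X) : Continuous fun y => green R o y z :=
  (((hc.comp (continuous_id.prodMk continuous_const)).add continuous_const).sub
    (hc.comp (continuous_id.prodMk continuous_const))).div_const 2

theorem theorem2p17 {B : Type*} [MetricSpace B] [CompactSpace B] [MeasurableSpace B] [BorelSpace B]
    (An : ℕ → Set B) (A : Set B)
    (hAn : ∀ n, IsCompact (An n)) (hA : IsCompact A)
    (hHausdorff : Tendsto (fun n => Metric.hausdorffEDist (An n) A) atTop (𝓝 0))
    (μn : ℕ → ProbabilityMeasure B) (μ : ProbabilityMeasure B)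
    (hμn : ∀ n, (μn n : Measure B).support = An n) (hμ : (μ : Measure B).support = A)
    (hweak : Tendsto μn atTop (𝓝 μ))
    (Rn : ∀ n, An n → An n → ℝ) (R : A → A → ℝ)
    (hRn : ∀ n, IsResistanceMetric (Rn n))
    (hRn_cont : ∀ n, Continuous (fun p : An n × An n => Rn n p.1 p.2))
    (hR : IsMetricOn R)
    (hconv : KernelTendsto Rn R) :
    IsResistanceMetric R ∧ Continuous (fun p : A × A => R p.1 p.2) ∧
    ∀ α : ℝ, 0 < α →
      -- the resolvent kernels are well defined
      (∀ n, ∃! u : An n → An n → ℝ, IsResolventKernel (Rn n) (measureOn (An n) (μn n)) α u) ∧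
      (∃! u : A → A → ℝ, IsResolventKernel R (measureOn A μ) α u) ∧
      -- the kernels are continuous and converge
      ∀ (un : ∀ n, An n → An n → ℝ) (u : A → A → ℝ),
        (∀ n, IsResolventKernel (Rn n) (measureOn (An n) (μn n)) α (un n)) →
        IsResolventKernel R (measureOn A μ) α u →
        (∀ n, Continuous (fun p : An n × An n => un n p.1 p.2)) ∧ KernelTendsto un u := by
  have hne : ∀ n, (An n).Nonempty := fun n => by
    rw [← hμn n]
    exact Measure.nonempty_support (IsProbabilityMeasure.ne_zero _)
  have happ := exists_tendsto_of_hausdorff hAn hne hHausdorff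
  choose xs hxs using happ
  have happ : ∀ y : A, ∃ yn : ∀ n, An n, Tendsto (fun n => (yn n : B)) atTop (𝓝 (y : B)) :=
    fun y => ⟨xs y, hxs y⟩
  have hRres : IsResistanceMetric R := isResistanceMetric_of_tendsto hRn hR (fun n x => xs x n)
    fun x y => hconv x y _ _ (hxs x) (hxs y)
  have hRleft : ∀ (x : A) (xn : ∀ n, An n), Tendsto (fun n => (xn n : B)) atTop (𝓝 (x : B)) →
      FunTendsto (fun n y => Rn n y (xn n)) (fun y => R y x) :=
    fun x xn hx y yn hy => hconv y x yn xn hy hx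
  have hRc : Continuous (fun p : A × A => R p.1 p.2) :=
    continuous_of_continuous_left hR fun x => (hRleft x _ (hxs x)).continuous happ
  have hprobn : ∀ n, IsProbabilityMeasure (measureOn (An n) (μn n : Measure B)) :=
    fun n => isProbabilityMeasure_measureOn (hAn n).isClosed (hμn n)
  have hprob : IsProbabilityMeasure (measureOn A (μ : Measure B)) :=
    isProbabilityMeasure_measureOn hA.isClosed hμ
  have hcompn : ∀ n, CompactSpace (An n) := fun n => isCompact_iff_compactSpace.1 (hAn n)
  have hcomp : CompactSpace A := isCompact_iff_compactSpace.1 hA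
  refine ⟨hRres, hRc, fun α hα => ⟨fun n =>
    (hRn n).existsUnique_resolventKernel (hRn_cont n) _ hα,
    hRres.existsUnique_resolventKernel hRc _ hα, fun un u hun hu =>
    ⟨fun n => (hun n).continuous (hRn_cont n) hα, ?_⟩⟩⟩
  have huc := hu.continuous hRc hα
  obtain ⟨𝓔, h𝓔, hu⟩ := hu
  obtain rfl : 𝓔.resistance = R := funext fun p => funext fun q => h𝓔 p q
  choose hmem hu using hu
  choose 𝓔n h𝓔n hun using hun
  obtain rfl : (fun n => (𝓔n n).resistance) = Rn :=
    funext fun n => funext fun p => funext fun q => h𝓔n n p q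
  choose hmemn hun using hun
  intro x y xn yn hx hy
  -- The limit kernel with first argument frozen at `x` becomes the trial function for every `n`.
  obtain ⟨U, hU, hUu⟩ := exists_continuous_extension hA.isClosed
    (huc.comp (continuous_const.prodMk continuous_id : Continuous fun z : A => (x, z)))
  simp only [Function.comp_apply] at hUu
  -- a uniform bound for the resistance metrics
  obtain ⟨K, hK⟩ : ∃ K, ∀ᶠ n in atTop, ∀ y z, (𝓔n n).resistance y z ≤ K := by
    have hcl := (hRleft x xn hx).continuous happ
    obtain ⟨H, hH, hHR⟩ := exists_continuous_extension hA.isClosed hcl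
    obtain ⟨M, hM⟩ := (isCompact_range hH).bddAbove
    refine ⟨4 * (M + 1), ?_⟩
    filter_upwards [(hRleft x xn hx).uniform hA hHausdorff happ hH hHR one_pos] with n hn y z
    have hle : ∀ y : An n, (𝓔n n).resistance y (xn n) ≤ M + 1 := fun y => by
      have h1 := (abs_lt.1 (hn y)).2
      have h2 : H y ≤ M := hM ⟨y, rfl⟩
      linarith
    have h1 := (𝓔n n).resistance_le_two_mul y (xn n) z
    have h2 := hle y
    have h3 := hle z
    rw [(𝓔n n).resistance_comm z] at h3
    linarith
  -- the approximate solutions of the integral equations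
  let v : ∀ n, An n → ℝ := fun n z => U (xn n) -
    α * ∫ y, U y * green (𝓔n n).resistance (xn n) y z ∂(measureOn (An n) (μn n))
  have hUn : Tendsto (fun n => U (xn n)) atTop (𝓝 (u x x)) := by
    rw [← hUu]
    exact (hU.tendsto _).comp hx
  -- The limit `u x` satisfies its integral equation exactly, so passing to the limit in the
  -- right-hand side returns `u x`, which is `U` on `A`.
  have hv : FunTendsto v (u x) := by
    intro z zn hz
    have hint := FunTendsto.integral hAn hA hHausdorff happ hμn hμ hweak
      (hn := fun n y => U y * green (𝓔n n).resistance (xn n) y (zn n))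
      (h := fun y => u x y * green 𝓔.resistance x y z)
      (fun n => (hU.comp continuous_subtype_val).mul (continuous_green (hRn_cont n) _ _))
      (fun y yn hy => by
        refine Tendsto.mul ?_ ((((hconv y x yn xn hy hx).add (hconv z x zn xn hz hx)).sub
          (hconv y z yn zn hy hz)).div_const 2)
        rw [← hUu]
        exact (hU.tendsto _).comp hy)
    have heq : u x z = u x x - α * ∫ y, u x y * green 𝓔.resistance x y z ∂(measureOn A μ) :=
      ResistanceForm.resolvent_eq (u := ⟨u x, hmem x⟩) (hu x) z
    rw [heq]
    exact hUn.sub (hint.const_mul α)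
  have hmass : Tendsto (fun n => |1 - α * ∫ y : An n, U y ∂(measureOn (An n) (μn n))|)
      atTop (𝓝 0) := by
    have hint := FunTendsto.integral hAn hA hHausdorff happ hμn hμ hweak
      (hn := fun n (y : An n) => U y) (h := u x) (fun n => hU.comp continuous_subtype_val)
      (fun y yn hy => by rw [← hUu]; exact (hU.tendsto _).comp hy)
    have := ((hint.const_mul α).const_sub 1).abs
    have hone : α * ∫ y, u x y ∂(measureOn A μ) = 1 :=
      ResistanceForm.resolvent_mass (u := ⟨u x, hmem x⟩) (hu x)
    rwa [hone, sub_self, abs_zero] at this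
  have hdiff : Tendsto (fun n => un n (xn n) (yn n) - U (yn n)) atTop (𝓝 0) := by
    have hK0 : 0 ≤ K := by
      obtain ⟨n, hn⟩ := hK.exists
      exact ((𝓔n n).resistance_nonneg (xn n) (xn n)).trans (hn _ _)
    have hC : 0 < 2 * K + 2 / α := by positivity
    refine Metric.tendsto_nhds.2 fun ε hε => ?_
    -- Chosen so that the equation defect and the distance from `v n` to `U` together cost `ε / 2`,
    -- leaving `ε / 2` for the mass defect.
    set δ := ε / (2 * ((2 * K + 2 / α) * α + 1)) with hδ
    have hδ0 : 0 < δ := by positivity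
    have hδε : ((2 * K + 2 / α) * α + 1) * δ = ε / 2 := by
      rw [hδ]; field_simp
    have hsmall := (hmass.const_mul (2 * K + 2 / α)).eventually
      (gt_mem_nhds (show (2 * K + 2 / α) * 0 < ε / 2 by rw [mul_zero]; exact half_pos hε))
    filter_upwards [hK, hsmall, hv.uniform hA hHausdorff happ hU hUu hδ0] with n hKn hmn hvn
    have h1 := ResistanceForm.abs_resolvent_sub_le (hRn_cont n)
      (u := ⟨un n (xn n), hmemn n (xn n)⟩) (hun n (xn n)) hα hKn
      (hU.comp continuous_subtype_val) (δ := δ)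
      (fun z => by rw [abs_sub_comm]; exact (hvn z).le) (yn n)
    have h2 := hvn (yn n)
    rw [dist_zero_right, Real.norm_eq_abs]
    calc |un n (xn n) (yn n) - U (yn n)|
        ≤ |un n (xn n) (yn n) - v n (yn n)| + |v n (yn n) - U (yn n)| := abs_sub_le _ _ _
      _ < (2 * K + 2 / α) * (|1 - α * ∫ y : An n, U y ∂(measureOn (An n) (μn n))| + α * δ) + δ :=
        add_lt_add_of_le_of_lt h1 h2
      _ < ε := by linarith
  have hlim : Tendsto (fun n => U (yn n)) atTop (𝓝 (u x y)) := by
    rw [← hUu]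
    exact (hU.tendsto _).comp hy
  simpa using hdiff.add hlim
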